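/- Let $k$ be a finite field, $G$ a profinite group, $H$ a closed subgroup of $G$, and $k[[G]]=\varprojlim_{N} k[G/N]$ ($N$ running over the open normal subgroups of $G$, written $N\lhd_O G$) the completed group algebra. A profinite $k[[G]]$-module is a profinite abelian group with a continuous $k[[G]]$-module structure, and homomorphisms of profinite modules are continuous. For a closed subgroup $L\le G$, $U{\downarrow}_L$ denotes restriction to $k[[L]]$ and $V{\uparrow}^G=k[[G]]\,\widehat{\otimes}_{k[[L]]}V$ denotes induction; $U$ is called relatively $L$-projective if for every epimorphism $\beta:V\to W$ and every homomorphism $\varphi:U\to W$ of profinite $k[[G]]$-modules, whenever there is a $k[[L]]$-homomorphism $\sigma:U\to V$ with $\beta\sigma=\varphi$ there is a $k[[G]]$-homomorphism $\rho:U\to V$ with $\beta\rho=\varphi$. "Direct summand" means isomorphic to a direct summand, with continuous splitting maps. For $N\lhd_O G$, $U_N$ is the module of coinvariants $k\,\widehat{\otimes}_{k[[N]]}U$, i.e. the largest quotient of the profinite $k[[G]]$-module $U$ on which $N$ acts trivially. For an open subgroup $L\le G$ and a continuous $k[[L]]$-endomorphism $\alpha$ of $U$, put $\mathrm{Tr}_{L,G}(\alpha)=\sum_{s\in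 G/L}s\alpha s^{-1}$, a continuous $k[[G]]$-endomorphism of $U$. Let $U$ be a finitely generated profinite $k[[G]]$-module. Then the following are equivalent: 1. $U$ is relatively $H$-projective. 2. Every continuous $k[[G]]$-epimorphism $V\to U$ from a profinite $k[[G]]$-module $V$ that splits as a homomorphism of $k[[H]]$-modules splits as a homomorphism of $k[[G]]$-modules. 3. $U$ is a direct summand of $U{\downarrow}_H{\uparrow}^G$. 4. $U$ is relatively $HN$-projective for every $N\lhd_O G$. 5. $U_N$ is relatively $HN$-projective for every $N\lhd_O G$. 6. $U$ is a direct summand of $V{\uparrow}^G$ for some profinite $k[[H]]$-module $V$. 7. For every $N\lhd_O G$ there is a continuous $k[[HN]]$-endomorphism $\alpha_N$ of $U$ with $\mathrm{id}_U=\mathrm{Tr}_{HN,G}(\alpha_N)$. -/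

import Mathlib

universe u

/-! ### The completed group algebra -/

section CompletedGroupAlgebra

/-- For `N ≤ M` normal in `G`, the canonical map `k[G/N] → k[G/M]`. -/
noncomputable def groupAlgebraTransition (k : Type u) {G : Type u} [Field k] [Group G]
    {N M : Subgroup G} [N.Normal] [M.Normal] (h : N ≤ M) :
    MonoidAlgebra k (G ⧸ N) →ₐ[k] MonoidAlgebra k (G ⧸ M) :=
  MonoidAlgebra.mapDomainAlgHom k k (QuotientGroup.map N M (MonoidHom.id G) (fun _ ha => h ha))

/-- For `H ≤ G` and `N` normal in `G`, the canonical map `k[H/(H ∩ N)] → k[G/N]`. -/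
noncomputable def groupAlgebraIncl (k : Type u) {G : Type u} [Field k] [Group G]
    (H N : Subgroup G) [N.Normal] :
    MonoidAlgebra k (H ⧸ N.subgroupOf H) →ₐ[k] MonoidAlgebra k (G ⧸ N) :=
  MonoidAlgebra.mapDomainAlgHom k k (QuotientGroup.map _ N H.subtype le_rfl)

theorem groupAlgebraTransition_single (k : Type u) {G : Type u} [Field k] [Group G]
    {N M : Subgroup G} [N.Normal] [M.Normal] (h : N ≤ M) (g : G) (c : k) :
    groupAlgebraTransition k h (MonoidAlgebra.single (g : G ⧸ N) c) =
      MonoidAlgebra.single (g : G ⧸ M) c := by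
  simp only [groupAlgebraTransition, MonoidAlgebra.mapDomainAlgHom_apply,
    MonoidAlgebra.mapDomain_single]
  rfl

theorem groupAlgebraIncl_single (k : Type u) {G : Type u} [Field k] [Group G]
    (H N : Subgroup G) [N.Normal] (g : H) (c : k) :
    groupAlgebraIncl k H N (MonoidAlgebra.single (g : H ⧸ N.subgroupOf H) c) =
      MonoidAlgebra.single ((g : G) : G ⧸ N) c := by
  simp only [groupAlgebraIncl, MonoidAlgebra.mapDomainAlgHom_apply,
    MonoidAlgebra.mapDomain_single]
  rfl

theorem groupAlgebraTransition_incl (k : Type u) {G : Type u} [Field k] [Group G]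
    (H : Subgroup G) {N M : Subgroup G} [N.Normal] [M.Normal] (h : N ≤ M)
    (h' : N.subgroupOf H ≤ M.subgroupOf H) (x : MonoidAlgebra k (H ⧸ N.subgroupOf H)) :
    groupAlgebraTransition k h (groupAlgebraIncl k H N x) =
      groupAlgebraIncl k H M (groupAlgebraTransition k h' x) := by
  induction x using MonoidAlgebra.induction_linear with
  | zero => simp only [map_zero]
  | add a b ha hb => simp only [map_add, ha, hb]
  | single q c =>
    obtain ⟨g, rfl⟩ := QuotientGroup.mk_surjective q
    rw [groupAlgebraIncl_single, groupAlgebraTransition_single, groupAlgebraTransition_single,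
      groupAlgebraIncl_single]

/-- The underlying algebra of `k[[G]]`: the inverse limit of the group algebras `k[G/N]` over the
open normal subgroups `N` of `G`, as a subalgebra of their product. -/
def completedGroupSubalgebra (k G : Type u) [Field k] [Group G] [TopologicalSpace G] :
    Subalgebra k ((N : OpenNormalSubgroup G) → MonoidAlgebra k (G ⧸ N.toSubgroup)) where
  carrier := {f | ∀ (N M : OpenNormalSubgroup G) (h : N.toSubgroup ≤ M.toSubgroup),
    groupAlgebraTransition k h (f N) = f M}
  mul_mem' := by
    intro a b ha hb N M h
    rw [Pi.mul_apply, map_mul, ha N M h, hb N M h, Pi.mul_apply]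
  add_mem' := by
    intro a b ha hb N M h
    rw [Pi.add_apply, map_add, ha N M h, hb N M h, Pi.add_apply]
  algebraMap_mem' := by
    intro c N M h
    rw [Pi.algebraMap_apply, AlgHom.commutes, Pi.algebraMap_apply]

/-- The completed group algebra `k[[G]]`. -/
def CompletedGroupAlgebra (k G : Type u) [Field k] [Group G] [TopologicalSpace G] : Type u :=
  ↥(completedGroupSubalgebra k G)

variable (k G : Type u) [Field k] [Group G] [TopologicalSpace G]

noncomputable instance : Ring (CompletedGroupAlgebra k G) :=
  inferInstanceAs (Ring ↥(completedGroupSubalgebra k G))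

noncomputable instance : Algebra k (CompletedGroupAlgebra k G) :=
  inferInstanceAs (Algebra k ↥(completedGroupSubalgebra k G))

/-- The discrete topology on a group algebra. -/
@[reducible] def groupAlgebraDiscrete (Q : Type u) : TopologicalSpace (MonoidAlgebra k Q) := ⊥

attribute [local instance] groupAlgebraDiscrete

/-- `k[[G]]` carries the inverse limit topology (each `k[G/N]` being discrete). -/
instance : TopologicalSpace (CompletedGroupAlgebra k G) :=
  inferInstanceAs (TopologicalSpace ↥(completedGroupSubalgebra k G))

instance : IsTopologicalRing (CompletedGroupAlgebra k G) :=
  have (Q : Type u) : DiscreteTopology (MonoidAlgebra k Q) := ⟨rfl⟩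
  inferInstanceAs (IsTopologicalRing ↥(completedGroupSubalgebra k G).toSubring)

namespace CompletedGroupAlgebra

variable {k G}

/-- The projection `k[[G]] → k[G/N]`. -/
noncomputable def proj (N : OpenNormalSubgroup G) :
    CompletedGroupAlgebra k G →ₐ[k] MonoidAlgebra k (G ⧸ N.toSubgroup) :=
  (Pi.evalAlgHom k (fun N : OpenNormalSubgroup G => MonoidAlgebra k (G ⧸ N.toSubgroup)) N).comp
    (completedGroupSubalgebra k G).val

theorem ext_proj {x y : CompletedGroupAlgebra k G} (h : ∀ N, proj N x = proj N y) : x = y :=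
  Subtype.ext (funext h)

theorem proj_compat (x : CompletedGroupAlgebra k G) {N M : OpenNormalSubgroup G}
    (h : N.toSubgroup ≤ M.toSubgroup) :
    groupAlgebraTransition k h (proj N x) = proj M x :=
  x.2 N M h

theorem continuous_proj (N : OpenNormalSubgroup G) :
    Continuous (proj N : CompletedGroupAlgebra k G → MonoidAlgebra k (G ⧸ N.toSubgroup)) :=
  (continuous_apply N).comp continuous_subtype_val

theorem isOpen_proj_fiber (N : OpenNormalSubgroup G)
    (s : Set (MonoidAlgebra k (G ⧸ N.toSubgroup))) :
    IsOpen {x : CompletedGroupAlgebra k G | proj N x ∈ s} :=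
  have : DiscreteTopology (MonoidAlgebra k (G ⧸ N.toSubgroup)) := ⟨rfl⟩
  (isOpen_discrete s).preimage (continuous_proj N)

theorem continuous_of_proj {X : Type*} [TopologicalSpace X] {f : X → CompletedGroupAlgebra k G}
    (h : ∀ N, Continuous fun x => proj N (f x)) : Continuous f :=
  Continuous.subtype_mk (continuous_pi h) (fun x => (f x).2)

variable (k) in
/-- The canonical map `G → k[[G]]`. -/
noncomputable def of : G →* CompletedGroupAlgebra k G where
  toFun g := ⟨fun N => MonoidAlgebra.of k (G ⧸ N.toSubgroup) (g : G ⧸ N.toSubgroup), by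
    intro N M h
    exact groupAlgebraTransition_single k h g 1⟩
  map_one' := ext_proj fun _ => map_one _
  map_mul' a b := ext_proj fun N => 
    map_mul (MonoidAlgebra.of k (G ⧸ N.toSubgroup)) (a : G ⧸ N.toSubgroup) (b : G ⧸ N.toSubgroup)

theorem proj_of (N : OpenNormalSubgroup G) (g : G) :
    proj N (of k g) = MonoidAlgebra.of k (G ⧸ N.toSubgroup) (g : G ⧸ N.toSubgroup) := rfl

/-- The open normal subgroup `H ∩ N` of `H`, for `N` open normal in `G`. -/
def interOpenNormal (H : Subgroup G) (N : OpenNormalSubgroup G) : OpenNormalSubgroup H where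
  toOpenSubgroup := N.toOpenSubgroup.comap H.subtype continuous_subtype_val
  isNormal' := Subgroup.Normal.comap N.isNormal' H.subtype

variable (k) in
/-- The homomorphism `k[[H]] → k[[G]]` induced by the inclusion of a subgroup `H ≤ G`; in the
`N`-th coordinate it is `k[H/(H ∩ N)] → k[G/N]`. -/
noncomputable def incl (H : Subgroup G) :
    CompletedGroupAlgebra k H →ₐ[k] CompletedGroupAlgebra k G where
  toFun x := ⟨fun N => groupAlgebraIncl k H N.toSubgroup (proj (interOpenNormal H N) x),
    fun N M h => (groupAlgebraTransition_incl k H h (Subgroup.comap_mono h) _).trans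
      (congrArg (groupAlgebraIncl k H M.toSubgroup)
        (proj_compat x (N := interOpenNormal H N) (M := interOpenNormal H M)
          (Subgroup.comap_mono h)))⟩
  map_one' := ext_proj fun N =>
    (congrArg (groupAlgebraIncl k H N.toSubgroup) (map_one _)).trans (map_one _)
  map_zero' := ext_proj fun N =>
    (congrArg (groupAlgebraIncl k H N.toSubgroup) (map_zero _)).trans (map_zero _)
  map_mul' x y := ext_proj fun N =>
    (congrArg (groupAlgebraIncl k H N.toSubgroup) (map_mul _ x y)).trans (map_mul _ _ _)
  map_add' x y := ext_proj fun N =>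
    (congrArg (groupAlgebraIncl k H N.toSubgroup) (map_add _ x y)).trans (map_add _ _ _)
  commutes' c := ext_proj fun N =>
    (congrArg (groupAlgebraIncl k H N.toSubgroup) (AlgHom.commutes _ c)).trans
      (AlgHom.commutes _ c)

theorem proj_incl (H : Subgroup G) (N : OpenNormalSubgroup G) (x : CompletedGroupAlgebra k H) :
    proj N (incl k H x) = groupAlgebraIncl k H N.toSubgroup (proj (interOpenNormal H N) x) := rfl

theorem continuous_incl (H : Subgroup G) :
    Continuous (incl k H : CompletedGroupAlgebra k H → CompletedGroupAlgebra k G) :=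
  continuous_of_proj fun N =>
    have (Q : Type u) : DiscreteTopology (MonoidAlgebra k Q) := ⟨rfl⟩
    (continuous_of_discreteTopology (f := groupAlgebraIncl k H N.toSubgroup)).comp (continuous_proj (interOpenNormal H N))

variable (k) in
/-- The homomorphism `k[[H]] → k[[G]]` as a ring homomorphism. -/
noncomputable def inclRingHom (H : Subgroup G) :
    CompletedGroupAlgebra k H →+* CompletedGroupAlgebra k G :=
  (incl k H).toRingHom

theorem continuous_inclRingHom (H : Subgroup G) : Continuous (inclRingHom k H) :=
  continuous_incl H

theorem incl_of (H : Subgroup G) (h : H) : incl k H (of k h) = of k (h : G) :=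
  ext_proj fun N => by
    exact groupAlgebraIncl_single k H N.toSubgroup h 1

/-- The abstract group algebra is dense in `k[[G]]`. -/
theorem dense_induction (S : Set (CompletedGroupAlgebra k G)) (hS : IsClosed S)
    (hadd : ∀ x ∈ S, ∀ y ∈ S, x + y ∈ S)
    (hof : ∀ (c : k) (g : G), algebraMap k _ c * of k g ∈ S) (x : CompletedGroupAlgebra k G) :
    x ∈ S := by
  have key : ∀ (M : OpenNormalSubgroup G) (z : MonoidAlgebra k (G ⧸ M.toSubgroup)),
      ∃ y ∈ S, proj M y = z := by
    intro M z
    induction z using MonoidAlgebra.induction_linear with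
    | zero => exact ⟨_, hof 0 1, by simp⟩
    | add a b ha hb =>
      obtain ⟨y, hy, rfl⟩ := ha
      obtain ⟨y', hy', rfl⟩ := hb
      exact ⟨y + y', hadd _ hy _ hy', map_add _ _ _⟩
    | single q c =>
      obtain ⟨g, rfl⟩ := QuotientGroup.mk_surjective q
      refine ⟨_, hof c g, ?_⟩
      rw [map_mul, AlgHom.commutes, proj_of, MonoidAlgebra.of_apply]
      simp [MonoidAlgebra.coe_algebraMap, MonoidAlgebra.single_mul_single]
  rw [← hS.closure_eq]
  have hind : Topology.IsInducing
      (fun (x : CompletedGroupAlgebra k G) (N : OpenNormalSubgroup G) => proj N x) :=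
    Topology.IsInducing.subtypeVal
  rw [mem_closure_iff]
  intro O hO hx
  obtain ⟨O', hO', rfl⟩ := hind.isOpen_iff.1 hO
  obtain ⟨I, t, ht, hsub⟩ := isOpen_pi_iff.1 hO' _ hx
  have : Nonempty (OpenNormalSubgroup G) := ⟨⟨⊤, by
    change (⊤ : Subgroup G).Normal
    infer_instance⟩⟩
  obtain ⟨M, hM⟩ := Finset.exists_le (α := (OpenNormalSubgroup G)ᵒᵈ) I
  obtain ⟨y, hy, hyx⟩ := key M (proj M x)
  refine ⟨y, hsub ?_, hy⟩
  intro N hN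
  have hMN : M.toSubgroup ≤ N.toSubgroup := hM N hN
  have : proj N y = proj N x := by rw [← proj_compat y hMN, ← proj_compat x hMN, hyx]
  change proj N y ∈ t N
  rw [this]
  exact (ht N hN).2

end CompletedGroupAlgebra

end CompletedGroupAlgebra

/-! ### Profinite modules -/

/-- A profinite module over a topological ring `R`: a profinite abelian group with a continuous
`R`-module structure.  Morphisms are the continuous `R`-linear maps `U →L[R] W`. -/
structure ProfiniteModule (R : Type u) [Ring R] [TopologicalSpace R] where
  carrier : Type u
  [addCommGroup : AddCommGroup carrier]
  [module : Module R carrier]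
  [topologicalSpace : TopologicalSpace carrier]
  [isTopologicalAddGroup : IsTopologicalAddGroup carrier]
  [compactSpace : CompactSpace carrier]
  [t2Space : T2Space carrier]
  [totallyDisconnectedSpace : TotallyDisconnectedSpace carrier]
  [continuousSMul : ContinuousSMul R carrier]

namespace ProfiniteModule

attribute [instance] addCommGroup module topologicalSpace isTopologicalAddGroup compactSpace
  t2Space totallyDisconnectedSpace continuousSMul

instance (R : Type u) [Ring R] [TopologicalSpace R] :
    CoeSort (ProfiniteModule R) (Type u) := ⟨carrier⟩

section Generic

set_option linter.unusedSectionVars false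

variable {R S : Type u} [Ring R] [TopologicalSpace R] [Ring S] [TopologicalSpace S]

/-- `U` is isomorphic to a direct summand of `W`, with continuous splitting maps. -/
def IsSummand (U W : ProfiniteModule R) : Prop :=
  ∃ (i : U →L[R] W) (π : W →L[R] U), π.comp i = ContinuousLinearMap.id R U

/-- The homomorphism `β` splits as a homomorphism of profinite modules. -/
def Splits {V U : ProfiniteModule R} (β : V →L[R] U) : Prop :=
  ∃ σ : U →L[R] V, β.comp σ = ContinuousLinearMap.id R U

/-- Restriction of scalars along a continuous ring homomorphism. -/
def restrictScalars (φ : S →+* R) (hφ : Continuous φ) (U : ProfiniteModule R) :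
    ProfiniteModule S :=
  letI : Module S U := Module.compHom U φ
  { carrier := U
    continuousSMul := ⟨(hφ.comp continuous_fst).smul continuous_snd⟩ }

/-- Restriction of scalars on morphisms (the same map). -/
def restrictScalarsHom (φ : S →+* R) (hφ : Continuous φ) {U W : ProfiniteModule R}
    (f : U →L[R] W) : restrictScalars φ hφ U →L[S] restrictScalars φ hφ W where
  toFun := f
  map_add' := f.map_add
  map_smul' s u := f.map_smul (φ s) u
  cont := f.cont

/-! #### The completed tensor product `R ⊗̂_S V` -/

open scoped TensorProduct in
/-- The abstract tensor product `R ⊗_S V` over the (non-commutative) ring `S`, where `S` acts on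
the right of `R` through `φ : S → R`, as a left `R`-module. -/
abbrev AbstractTensor (φ : S →+* R) (V : ProfiniteModule S) : Type u :=
  (R ⊗[ℤ] V) ⧸ (Submodule.span R
    {t : R ⊗[ℤ] V | ∃ (r : R) (s : S) (v : V), t = (r * φ s) ⊗ₜ[ℤ] v - r ⊗ₜ[ℤ] (s • v)})

open scoped TensorProduct in
/-- The pure tensor `r ⊗ v` in `R ⊗_S V`. -/
def pureTensor (φ : S →+* R) (V : ProfiniteModule S) (r : R) (v : V) : AbstractTensor φ V :=
  Submodule.Quotient.mk (r ⊗ₜ[ℤ] v)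

open scoped TensorProduct in
theorem smul_pureTensor (φ : S →+* R) (V : ProfiniteModule S) (a r : R) (v : V) :
    a • pureTensor φ V r v = pureTensor φ V (a * r) v := by
  rw [pureTensor, ← Submodule.Quotient.mk_smul, TensorProduct.smul_tmul', smul_eq_mul]
  rfl

open scoped TensorProduct in
theorem pureTensor_balanced (φ : S →+* R) (V : ProfiniteModule S) (r : R) (s : S) (v : V) :
    pureTensor φ V (r * φ s) v = pureTensor φ V r (s • v) :=
  (Submodule.Quotient.eq _).2 (Submodule.subset_span ⟨r, s, v, rfl⟩)

open scoped TensorProduct in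
theorem abstractTensor_induction (φ : S →+* R) (V : ProfiniteModule S)
    {P : AbstractTensor φ V → Prop} (h0 : P 0) (hadd : ∀ x y, P x → P y → P (x + y))
    (hp : ∀ r v, P (pureTensor φ V r v)) (x : AbstractTensor φ V) : P x := by
  obtain ⟨t, rfl⟩ := Submodule.Quotient.mk_surjective _ x
  induction t using TensorProduct.induction_on with
  | zero => exact h0
  | tmul r v => exact hp r v
  | add a b ha hb => exact hadd _ _ ha hb

/-- The open submodules of `R ⊗_S V`: the `R`-submodules `K` of finite index for which
`R × V → (R ⊗_S V)/K`, `(r, v) ↦ r ⊗ v + K`, is continuous for the discrete topology. -/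
structure OpenTensorSubmodule (φ : S →+* R) (V : ProfiniteModule S) where
  ker : Submodule R (AbstractTensor φ V)
  finite : Finite (AbstractTensor φ V ⧸ ker)
  locallyConstant : IsLocallyConstant fun p : R × V => ker.mkQ (pureTensor φ V p.1 p.2)

attribute [instance] OpenTensorSubmodule.finite

/-- The finite quotient of `R ⊗_S V` by an open submodule. -/
def OpenTensorSubmodule.Quot {φ : S →+* R} {V : ProfiniteModule S}
    (K : OpenTensorSubmodule φ V) : Type u :=
  AbstractTensor φ V ⧸ K.ker

namespace OpenTensorSubmodule

variable {φ : S →+* R} {V : ProfiniteModule S}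

instance (K : OpenTensorSubmodule φ V) : AddCommGroup K.Quot :=
  inferInstanceAs (AddCommGroup (AbstractTensor φ V ⧸ K.ker))

instance (K : OpenTensorSubmodule φ V) : Module R K.Quot :=
  inferInstanceAs (Module R (AbstractTensor φ V ⧸ K.ker))

instance (K : OpenTensorSubmodule φ V) : Finite K.Quot := K.finite

instance (K : OpenTensorSubmodule φ V) : TopologicalSpace K.Quot := ⊥

instance (K : OpenTensorSubmodule φ V) : DiscreteTopology K.Quot := ⟨rfl⟩

/-- The quotient map `R ⊗_S V → (R ⊗_S V)/K`. -/
def mkQ (K : OpenTensorSubmodule φ V) : AbstractTensor φ V →ₗ[R] K.Quot := K.ker.mkQ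

theorem mkQ_surjective (K : OpenTensorSubmodule φ V) : Function.Surjective K.mkQ :=
  K.ker.mkQ_surjective

theorem continuous_mkQ_pureTensor (K : OpenTensorSubmodule φ V) :
    Continuous fun p : R × V => K.mkQ (pureTensor φ V p.1 p.2) :=
  @IsLocallyConstant.continuous _ _ _ ⊥ _ K.locallyConstant

/-- The transition map `(R ⊗_S V)/K → (R ⊗_S V)/L` for `K ≤ L`. -/
def transition {K L : OpenTensorSubmodule φ V} (h : K.ker ≤ L.ker) : K.Quot →ₗ[R] L.Quot :=
  Submodule.factor h

instance [IsTopologicalRing R] (K : OpenTensorSubmodule φ V) : ContinuousSMul R K.Quot := by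
  refine ⟨continuous_iff_continuousAt.2 ?_⟩
  rintro ⟨r, q⟩
  have hr : ∀ q : K.Quot, Continuous fun r : R => r • q := by
    intro q
    obtain ⟨t, rfl⟩ := K.mkQ_surjective q
    induction t using abstractTensor_induction with
    | h0 => simpa only [map_zero, smul_zero] using continuous_const
    | hadd x y hx hy =>
      simp only [map_add, smul_add]
      exact (continuous_of_discreteTopology (f := fun p : K.Quot × K.Quot => p.1 + p.2)).comp
        (hx.prodMk hy)
    | hp a v =>
      simp only [← map_smul, smul_pureTensor]
      exact K.continuous_mkQ_pureTensor.comp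
        ((continuous_id.mul continuous_const).prodMk continuous_const)
  have h1 : ∀ᶠ p : R × K.Quot in nhds (r, q), p.2 = q :=
    (continuous_snd.tendsto (r, q)).eventually
      ((isOpen_discrete {q}).mem_nhds rfl)
  have h2 : Filter.Tendsto (fun p : R × K.Quot => p.1 • q) (nhds (r, q)) (nhds (r • q)) :=
    ((hr q).comp continuous_fst).tendsto (r, q)
  exact h2.congr' (h1.mono fun p hp => by rw [← hp])

end OpenTensorSubmodule

/-- The inverse limit of the finite quotients of `R ⊗_S V` by its open submodules. -/
def tensorLimit (φ : S →+* R) (V : ProfiniteModule S) :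
    Submodule R ((K : OpenTensorSubmodule φ V) → K.Quot) where
  carrier := {x | ∀ (K L : OpenTensorSubmodule φ V) (h : K.ker ≤ L.ker),
    OpenTensorSubmodule.transition h (x K) = x L}
  zero_mem' := fun _ _ _ => map_zero _
  add_mem' := fun {a b} ha hb K L h => by
    rw [Pi.add_apply, map_add, ha K L h, hb K L h, Pi.add_apply]
  smul_mem' := fun r a ha K L h => by
    rw [Pi.smul_apply, map_smul, ha K L h, Pi.smul_apply]

theorem isClosed_tensorLimit (φ : S →+* R) (V : ProfiniteModule S) :
    IsClosed (tensorLimit φ V : Set ((K : OpenTensorSubmodule φ V) → K.Quot)) := by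
  have : (tensorLimit φ V : Set ((K : OpenTensorSubmodule φ V) → K.Quot)) =
      ⋂ (K : OpenTensorSubmodule φ V) (L : OpenTensorSubmodule φ V) (h : K.ker ≤ L.ker),
        {x | OpenTensorSubmodule.transition h (x K) = x L} := by
    ext x
    simp only [Set.mem_iInter]
    rfl
  rw [this]
  refine isClosed_iInter fun K => isClosed_iInter fun L => isClosed_iInter fun h => ?_
  exact isClosed_eq ((continuous_of_discreteTopology
    (f := OpenTensorSubmodule.transition h)).comp (continuous_apply K)) (continuous_apply L)

/-- The completed tensor product `R ⊗̂_S V`: the inverse limit of the finite quotients of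
`R ⊗_S V` by open submodules, with `R` acting on the left factor. -/
def completedTensor [IsTopologicalRing R] (φ : S →+* R) (V : ProfiniteModule S) :
    ProfiniteModule R where
  carrier := ↥(tensorLimit φ V)
  isTopologicalAddGroup := inferInstanceAs (IsTopologicalAddGroup (tensorLimit φ V).toAddSubgroup)
  compactSpace := isCompact_iff_compactSpace.1 (isClosed_tensorLimit φ V).isCompact

/-- The canonical map `R × V → R ⊗̂_S V`. -/
def completedPureTensor [IsTopologicalRing R] (φ : S →+* R) (V : ProfiniteModule S)
    (r : R) (v : V) : completedTensor φ V :=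
  ⟨fun K => K.mkQ (pureTensor φ V r v), fun _ _ _ => rfl⟩

/-- The quotient of a profinite module by a closed submodule. -/
def quotient (U : ProfiniteModule R) (C : Submodule R U) (hC : IsClosed (C : Set U)) :
    ProfiniteModule R where
  carrier := U ⧸ C
  compactSpace := Function.Surjective.compactSpace C.continuous_mkQ C.mkQ_surjective
  t2Space := have : IsClosed (C : Set U) := hC; inferInstance
  totallyDisconnectedSpace := by
    have : IsClosed (C : Set U) := hC
    have : TotallySeparatedSpace (U ⧸ C) := by
      rw [totallySeparatedSpace_iff_exists_isClopen]
      intro x y hxy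
      obtain ⟨x, rfl⟩ := C.mkQ_surjective x
      obtain ⟨y, rfl⟩ := C.mkQ_surjective y
      have hxC : x - y ∉ C := fun h => hxy ((Submodule.Quotient.eq C).2 h)
      have hO : IsOpen {z : U | x - y - z ∉ C} :=
        (hC.preimage (continuous_const.sub continuous_id)).isOpen_compl
      obtain ⟨O, hOsub⟩ := ProfiniteGrp.exist_openNormalAddSubgroup_sub_open_nhds_of_zero hO
        (by simpa using hxC)
      let D : AddSubgroup (U ⧸ C) := O.toAddSubgroup.map C.mkQ.toAddMonoidHom
      have hD : IsOpen (D : Set (U ⧸ C)) :=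
        C.isOpenMap_mkQ _ O.isOpen'
      have hDc : IsClosed (D : Set (U ⧸ C)) := AddSubgroup.isClosed_of_isOpen D hD
      refine ⟨{q | q - C.mkQ y ∉ D}, ⟨?_, ?_⟩, ?_, ?_⟩
      · exact (hD.preimage (continuous_id.sub continuous_const)).isClosed_compl
      · exact (hDc.preimage (continuous_id.sub continuous_const)).isOpen_compl
      · rintro ⟨z, hz, hzq⟩
        refine hOsub hz ((Submodule.Quotient.eq C).1 ?_)
        exact (by rw [map_sub]; exact hzq.symm : C.mkQ (x - y) = C.mkQ z)
      · intro h
        exact h (by simp)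
    infer_instance

end Generic

/-! ### Modules over completed group algebras -/

section Groups

variable {k G : Type u} [Field k] [Group G] [TopologicalSpace G]

/-- The restriction `U↓_H` of a `k[[G]]`-module to `k[[H]]`. -/
noncomputable def res (H : Subgroup G) (U : ProfiniteModule (CompletedGroupAlgebra k G)) :
    ProfiniteModule (CompletedGroupAlgebra k H) :=
  restrictScalars (CompletedGroupAlgebra.inclRingHom k H)
    (CompletedGroupAlgebra.continuous_inclRingHom H) U

/-- Restriction to `k[[H]]` on morphisms (the same map). -/
noncomputable def resHom (H : Subgroup G) {U W : ProfiniteModule (CompletedGroupAlgebra k G)}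
    (f : U →L[CompletedGroupAlgebra k G] W) :
    res H U →L[CompletedGroupAlgebra k H] res H W :=
  restrictScalarsHom (CompletedGroupAlgebra.inclRingHom k H)
    (CompletedGroupAlgebra.continuous_inclRingHom H) f

/-- The induced module `V↑^G = k[[G]] ⊗̂_{k[[H]]} V`. -/
noncomputable def ind (H : Subgroup G) (V : ProfiniteModule (CompletedGroupAlgebra k H)) :
    ProfiniteModule (CompletedGroupAlgebra k G) :=
  completedTensor (CompletedGroupAlgebra.inclRingHom k H) V

/-- The closed submodule of `U` generated by the elements `n u - u` with `n ∈ N`. -/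
noncomputable def augmentation (N : Subgroup G)
    (U : ProfiniteModule (CompletedGroupAlgebra k G)) :
    Submodule (CompletedGroupAlgebra k G) U :=
  (Submodule.span (CompletedGroupAlgebra k G)
    {x : U | ∃ n ∈ N, ∃ u : U, x = CompletedGroupAlgebra.of k n • u - u}).topologicalClosure

/-- The coinvariant module `U_N` of a normal subgroup `N`: the largest quotient of the profinite
`k[[G]]`-module `U` on which `N` acts trivially. -/
noncomputable def coinvariants (N : Subgroup G) [N.Normal]
    (U : ProfiniteModule (CompletedGroupAlgebra k G)) :
    ProfiniteModule (CompletedGroupAlgebra k G) :=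
  U.quotient (augmentation N U) (Submodule.isClosed_topologicalClosure _)

/-- `U` is relatively `H`-projective: for every epimorphism `β : V → W` and every `φ : U → W` of
profinite `k[[G]]`-modules, `φ` lifts through `β` over `k[[G]]` as soon as it does over
`k[[H]]`. -/
def IsRelativelyProjective (H : Subgroup G)
    (U : ProfiniteModule (CompletedGroupAlgebra k G)) : Prop :=
  ∀ (V W : ProfiniteModule.{u} (CompletedGroupAlgebra k G))
    (φ : U →L[CompletedGroupAlgebra k G] W) (β : V →L[CompletedGroupAlgebra k G] W),
    Function.Surjective β →
    (∃ σ : res H U →L[CompletedGroupAlgebra k H] res H V, (resHom H β).comp σ = resHom H φ) →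
    ∃ ρ : U →L[CompletedGroupAlgebra k G] V, β.comp ρ = φ

/-! #### The trace map -/

variable {U W : ProfiniteModule (CompletedGroupAlgebra k G)}

/-- The underlying function of a `k[[H]]`-homomorphism `U↓_H → W↓_H`. -/
noncomputable def resFun (H : Subgroup G) (α : res H U →L[CompletedGroupAlgebra k H] res H W) : U → W :=
  fun u => α u

theorem continuous_resFun (H : Subgroup G)
    (α : res H U →L[CompletedGroupAlgebra k H] res H W) : Continuous (resFun H α) :=
  α.continuous

theorem resFun_add (H : Subgroup G)
    (α : res H U →L[CompletedGroupAlgebra k H] res H W) (u v : U) :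
    resFun H α (u + v) = resFun H α u + resFun H α v :=
  α.map_add u v

theorem resFun_smul (H : Subgroup G)
    (α : res H U →L[CompletedGroupAlgebra k H] res H W) (r : CompletedGroupAlgebra k H) (u : U) :
    resFun H α (CompletedGroupAlgebra.incl k H r • u) =
      CompletedGroupAlgebra.incl k H r • resFun H α u :=
  α.map_smul r u

/-- The conjugate `s α s⁻¹` of a `k[[H]]`-homomorphism `α`, as a function. -/
noncomputable def conj (H : Subgroup G)
    (α : res H U →L[CompletedGroupAlgebra k H] res H W) (s : G) (u : U) : W :=
  CompletedGroupAlgebra.of k s • resFun H α (CompletedGroupAlgebra.of k s⁻¹ • u)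

theorem map_of_smul (H : Subgroup G)
    (α : res H U →L[CompletedGroupAlgebra k H] res H W) (h : H) (u : U) :
    resFun H α (CompletedGroupAlgebra.of k (h : G) • u) =
      CompletedGroupAlgebra.of k (h : G) • resFun H α u := by
  rw [← CompletedGroupAlgebra.incl_of H h]
  exact resFun_smul H α (CompletedGroupAlgebra.of k h) u

theorem map_algebraMap_smul (H : Subgroup G)
    (α : res H U →L[CompletedGroupAlgebra k H] res H W) (c : k) (u : U) :
    resFun H α (algebraMap k (CompletedGroupAlgebra k G) c • u) =
      algebraMap k (CompletedGroupAlgebra k G) c • resFun H α u := by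
  rw [← (CompletedGroupAlgebra.incl k H).commutes c]
  exact resFun_smul H α (algebraMap k (CompletedGroupAlgebra k H) c) u

theorem conj_mul (H : Subgroup G)
    (α : res H U →L[CompletedGroupAlgebra k H] res H W) (s : G) (h : H) (u : U) :
    conj H α (s * h) u = conj H α s u := by
  unfold conj
  rw [mul_inv_rev, map_mul, map_mul, mul_smul, mul_smul]
  congr 1
  have := map_of_smul H α h⁻¹ (CompletedGroupAlgebra.of k s⁻¹ • u : U)
  rw [Subgroup.coe_inv] at this
  rw [this, ← mul_smul, ← map_mul, mul_inv_cancel, map_one, one_smul]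

/-- The conjugate `s α s⁻¹`, which depends only on the coset `s ∈ G/H`. -/
noncomputable def cosetConj (H : Subgroup G)
    (α : res H U →L[CompletedGroupAlgebra k H] res H W) (u : U) (s : G ⧸ H) : W :=
  Quotient.liftOn' s (fun s => conj H α s u) fun a b hab => by
    have := conj_mul H α a ⟨a⁻¹ * b, QuotientGroup.leftRel_apply.1 hab⟩ u
    rw [← this]
    simp

theorem cosetConj_mk (H : Subgroup G)
    (α : res H U →L[CompletedGroupAlgebra k H] res H W) (u : U) (s : G) :
    cosetConj H α u (s : G ⧸ H) = conj H α s u := rfl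

theorem cosetConj_add (H : Subgroup G)
    (α : res H U →L[CompletedGroupAlgebra k H] res H W) (u v : U) (s : G ⧸ H) :
    cosetConj H α (u + v) s = cosetConj H α u s + cosetConj H α v s := by
  obtain ⟨s, rfl⟩ := QuotientGroup.mk_surjective s
  rw [cosetConj_mk, cosetConj_mk, cosetConj_mk, conj, conj, conj, smul_add, resFun_add, smul_add]

theorem cosetConj_of_smul (H : Subgroup G)
    (α : res H U →L[CompletedGroupAlgebra k H] res H W) (g : G) (u : U) (s : G ⧸ H) :
    cosetConj H α (CompletedGroupAlgebra.of k g • u) (g • s) =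
      CompletedGroupAlgebra.of k g • cosetConj H α u s := by
  obtain ⟨s, rfl⟩ := QuotientGroup.mk_surjective s
  change conj H α (g * s) _ = CompletedGroupAlgebra.of k g • conj H α s u
  unfold conj
  rw [← mul_smul, ← mul_smul, ← map_mul, ← map_mul, mul_inv_rev, inv_mul_cancel_right]

theorem cosetConj_algebraMap_smul (H : Subgroup G)
    (α : res H U →L[CompletedGroupAlgebra k H] res H W) (c : k) (u : U) (s : G ⧸ H) :
    cosetConj H α (algebraMap k (CompletedGroupAlgebra k G) c • u) s =
      algebraMap k (CompletedGroupAlgebra k G) c • cosetConj H α u s := by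
  obtain ⟨s, rfl⟩ := QuotientGroup.mk_surjective s
  rw [cosetConj_mk, cosetConj_mk]
  unfold conj
  rw [← mul_smul, ← Algebra.commutes, mul_smul, map_algebraMap_smul, ← mul_smul, ← mul_smul,
    ← Algebra.commutes]

theorem continuous_cosetConj (H : Subgroup G)
    (α : res H U →L[CompletedGroupAlgebra k H] res H W) (s : G ⧸ H) :
    Continuous fun u : U => cosetConj H α u s := by
  obtain ⟨s, rfl⟩ := QuotientGroup.mk_surjective s
  have h2 : Continuous fun u : U => CompletedGroupAlgebra.of k s⁻¹ • u :=
    continuous_const_smul _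
  exact ((continuous_resFun H α).comp h2).const_smul (CompletedGroupAlgebra.of k s)

/-- An additive continuous map commuting with the action of `k` and `G` is `k[[G]]`-linear. -/
theorem map_smul_of_commutes {f : U → W} (hf : Continuous f)
    (hadd : ∀ u v, f (u + v) = f u + f v)
    (hof : ∀ (g : G) u, f (CompletedGroupAlgebra.of k g • u) = CompletedGroupAlgebra.of k g • f u)
    (hk : ∀ (c : k) u, f (algebraMap k (CompletedGroupAlgebra k G) c • u) =
      algebraMap k (CompletedGroupAlgebra k G) c • f u)
    (r : CompletedGroupAlgebra k G) (u : U) : f (r • u) = r • f u := by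
  refine CompletedGroupAlgebra.dense_induction
    {r : CompletedGroupAlgebra k G | f (r • u) = r • f u} ?_ ?_ ?_ r
  · exact isClosed_eq (hf.comp (continuous_id.smul continuous_const))
      (continuous_id.smul continuous_const)
  · intro x hx y hy
    change f ((x + y) • u) = (x + y) • f u
    rw [add_smul, hadd, hx, hy, add_smul]
  · intro c g
    change f ((_ * _) • u) = (_ * _) • f u
    rw [mul_smul, hk, hof, mul_smul]

/-- The trace map `Tr_{H,G}(α) = ∑_{s ∈ G/H} s α s⁻¹` for an open subgroup `H` of `G`. -/
noncomputable def trace [IsTopologicalGroup G] [CompactSpace G] (H : Subgroup G)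
    (hH : IsOpen (H : Set G)) (α : res H U →L[CompletedGroupAlgebra k H] res H W) :
    U →L[CompletedGroupAlgebra k G] W :=
  have : Finite (G ⧸ H) := Subgroup.quotient_finite_of_isOpen H hH
  letI : Fintype (G ⧸ H) := Fintype.ofFinite _
  have hc : Continuous fun u : U => ∑ s : G ⧸ H, cosetConj H α u s :=
    continuous_finsetSum _ fun s _ => continuous_cosetConj H α s
  have ha : ∀ u v : U, ∑ s : G ⧸ H, cosetConj H α (u + v) s =
      ∑ s : G ⧸ H, cosetConj H α u s + ∑ s : G ⧸ H, cosetConj H α v s := fun u v => by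
    simp only [cosetConj_add, Finset.sum_add_distrib]
  { toFun := fun u => ∑ s : G ⧸ H, cosetConj H α u s
    map_add' := ha
    map_smul' := fun r u => map_smul_of_commutes hc ha
      (fun g u => by
        rw [Finset.smul_sum, ← Equiv.sum_comp (MulAction.toPerm g)]
        exact Finset.sum_congr rfl fun s _ => cosetConj_of_smul H α g u s)
      (fun c u => by
        rw [Finset.smul_sum]
        exact Finset.sum_congr rfl fun s _ => cosetConj_algebraMap_smul H α c u s) r u
    cont := hc }

end Groups

end ProfiniteModule

/-- For `N` open normal in `G`, the subgroup `HN` is open. -/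
theorem isOpen_sup_openNormal {G : Type u} [Group G] [TopologicalSpace G] [IsTopologicalGroup G]
    (H : Subgroup G) (N : OpenNormalSubgroup G) :
    IsOpen ((H ⊔ N.toSubgroup : Subgroup G) : Set G) :=
  Subgroup.isOpen_mono le_sup_right N.isOpen'

/-!
For a finite field `k` and a profinite group `G` the ring `R = k[[G]]` is compact, so the open
submodules of a profinite `R`-module form a neighbourhood basis of zero
(`exists_isOpen_submodule_subset`), and a profinite module is the inverse limit of its finite
quotients. This gives the universal property of the completed tensor product
(`exists_completedTensor_lift`), hence the adjunction between induction and restriction.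

The equivalence of relative `H`-projectivity with the splitting condition and with being a summand
of an induced module is formal: the counit `U↓_H↑^G → U` splits over `k[[H]]` by `u ↦ 1 ⊗ u`
(`isSummand_ind_res_of_splits`), and induced modules are relatively projective by the adjunction
(`isRelativelyProjective_ind`).

The remaining conditions are linked in a circle.

* Relative projectivity passes from `H` to `HN` (`IsRelativelyProjective.mono`).
* For an open subgroup `L`, relative `L`-projectivity makes the identity a trace from `L`
  (`IsRelativelyProjective.exists_trace_eq_id`, half of Higman's criterion). The proof lifts
  the identity of `U` through the summation map from functions `G/L → U` to `U`. The diagonal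
  `G`-action on these functions extends to `k[[G]]` by a ring homomorphism from `k[[G]]` to
  matrices over `k[[G]]` indexed by `G/L` (`completedCosetMatrix`).
* If the identity is a trace from `L ⊇ N`, then `U_N` is relatively `L`-projective, since lifts over
  `L` can be averaged (`isRelativelyProjective_coinvariants_of_trace`).
* If every `U_N` is relatively `HN`-projective, then `U` is relatively `H`-projective
  (`isRelativelyProjective_of_coinvariants`). Modulo an open submodule of the target, a
  `k[[H]]`-lift kills an open submodule of `U`, so for small `N` it factors through `U_N` and is
  `k[[HN]]`-linear. Hence there are `k[[G]]`-lifts modulo every open submodule. As `U` is finitely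
  generated, they form an inverse system of finite nonempty sets, which has a compatible family
  (`exists_lift_of_forall_isOpen`).
-/

/-! ### Open submodules and compactness -/

namespace CompletedGroupAlgebra

section Compactness

variable {k G : Type u} [Field k] [Group G] [TopologicalSpace G]

attribute [local instance] groupAlgebraDiscrete

theorem continuous_of [IsTopologicalGroup G] : Continuous (of k : G → CompletedGroupAlgebra k G) :=
  continuous_of_proj fun N =>
    have : DiscreteTopology (G ⧸ N.toSubgroup) := QuotientGroup.discreteTopology N.isOpen'
    (continuous_of_discreteTopology (f := MonoidAlgebra.of k (G ⧸ N.toSubgroup))).comp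
      (QuotientGroup.continuous_mk (N := N.toSubgroup))

/-- `k[[G]]` is a closed subspace of a product of finite discrete rings, as `k` is finite. -/
instance compactSpace [Finite k] [IsTopologicalGroup G] [CompactSpace G] :
    CompactSpace (CompletedGroupAlgebra k G) := by
  have hdisc (Q : Type u) : DiscreteTopology (MonoidAlgebra k Q) := ⟨rfl⟩
  have hfin (N : OpenNormalSubgroup G) : Finite (MonoidAlgebra k (G ⧸ N.toSubgroup)) := by
    have : Finite (G ⧸ N.toSubgroup) := Subgroup.quotient_finite_of_isOpen _ N.isOpen'
    have : Finite ((G ⧸ N.toSubgroup) →₀ k) := Finite.of_injective _ DFunLike.coe_injective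
    exact Finite.of_equiv _ MonoidAlgebra.coeffEquiv.symm
  have hcl : IsClosed (completedGroupSubalgebra k G :
      Set ((N : OpenNormalSubgroup G) → MonoidAlgebra k (G ⧸ N.toSubgroup))) := by
    change IsClosed {f : (N : OpenNormalSubgroup G) → MonoidAlgebra k (G ⧸ N.toSubgroup) |
      ∀ (N M : OpenNormalSubgroup G) (h : N.toSubgroup ≤ M.toSubgroup),
        groupAlgebraTransition k h (f N) = f M}
    simp only [Set.ofPred_forall]
    refine isClosed_iInter fun N => isClosed_iInter fun M => isClosed_iInter fun h => ?_
    exact isClosed_eq ((continuous_of_discreteTopology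
      (f := groupAlgebraTransition k h)).comp (continuous_apply N)) (continuous_apply M)
  exact isCompact_iff_compactSpace.1 hcl.isCompact

end Compactness

end CompletedGroupAlgebra

namespace ProfiniteModule

section OpenSubmodules

variable {R : Type u} [Ring R] [TopologicalSpace R]

theorem finite_quotient_of_isOpen (W : ProfiniteModule R) {P : Submodule R W}
    (hP : IsOpen (P : Set W)) : Finite (W ⧸ P) :=
  AddSubgroup.quotient_finite_of_isOpen P.toAddSubgroup hP

theorem discreteTopology_quotient_of_isOpen (W : ProfiniteModule R) {P : Submodule R W}
    (hP : IsOpen (P : Set W)) : DiscreteTopology (W ⧸ P) :=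
  QuotientAddGroup.discreteTopology (N := P.toAddSubgroup) hP

theorem isClosed_of_isOpen (W : ProfiniteModule R) {P : Submodule R W}
    (hP : IsOpen (P : Set W)) : IsClosed (P : Set W) :=
  AddSubgroup.isClosed_of_isOpen P.toAddSubgroup hP

/-- Open submodules form a neighbourhood basis of zero. By compactness of `R`, the largest
submodule contained in an open subgroup is again open. -/
theorem exists_isOpen_submodule_subset [CompactSpace R] (W : ProfiniteModule R) {O : Set W}
    (hO : IsOpen O) (h0 : (0 : W) ∈ O) :
    ∃ P : Submodule R W, IsOpen (P : Set W) ∧ (P : Set W) ⊆ O := by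
  obtain ⟨A, hA⟩ := ProfiniteGrp.exist_openNormalAddSubgroup_sub_open_nhds_of_zero hO h0
  let P : Submodule R W :=
    { carrier := {w | ∀ r : R, r • w ∈ A.toAddSubgroup}
      zero_mem' := fun r => by rw [smul_zero]; exact A.toAddSubgroup.zero_mem
      add_mem' := fun {a b} ha hb r => by
        rw [smul_add]; exact A.toAddSubgroup.add_mem (ha r) (hb r)
      smul_mem' := fun s a ha r => by rw [← mul_smul]; exact ha (r * s) }
  refine ⟨P, ?_, fun w hw => hA (show w ∈ A.toAddSubgroup by simpa only [one_smul] using hw 1)⟩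
  have hAo : IsOpen (A.toAddSubgroup : Set W) := A.isOpen'
  refine isOpen_iff_eventually.2 fun w hw => ?_
  have := isCompact_univ.eventually_forall_of_forall_eventually (x₀ := w) (K := (Set.univ : Set R))
    (P := fun w r => r • w ∈ A.toAddSubgroup) (fun r _ =>
      ((continuous_snd.smul continuous_fst).tendsto (w, r)).eventually
        (hAo.mem_nhds (hw r)))
  exact this.mono fun x hx r => hx r trivial

theorem eq_zero_of_forall_isOpen_mem [CompactSpace R] (W : ProfiniteModule R) {w : W}
    (h : ∀ P : Submodule R W, IsOpen (P : Set W) → w ∈ P) : w = 0 := by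
  by_contra hw
  obtain ⟨P, hP, hPO⟩ := W.exists_isOpen_submodule_subset (O := {w}ᶜ) isOpen_compl_singleton
    (fun h0 => hw h0.symm)
  exact hPO (h P hP) rfl

/-- A compatible family of continuous homomorphisms into the quotients of `W` by its open
submodules comes from a continuous homomorphism into `W`. -/
theorem exists_of_compatible [CompactSpace R] (W : ProfiniteModule R) {T : Type*} [AddCommGroup T]
    [TopologicalSpace T] [Module R T]
    (f : ∀ P : {P : Submodule R W // IsOpen (P : Set W)}, T →L[R] W ⧸ P.1)
    (compat : ∀ P Q : {P : Submodule R W // IsOpen (P : Set W)}, ∀ h : P.1 ≤ Q.1, ∀ x,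
      Submodule.factor h (f P x) = f Q x) :
    ∃ F : T →L[R] W, ∀ (P : {P : Submodule R W // IsOpen (P : Set W)}) x,
      P.1.mkQ (F x) = f P x := by
  have hex : ∀ x : T, ∃ w : W, ∀ P : {P : Submodule R W // IsOpen (P : Set W)},
      P.1.mkQ w = f P x := by
    intro x
    have : Nonempty {P : Submodule R W // IsOpen (P : Set W)} := ⟨⟨⊤, isOpen_univ⟩⟩
    have := IsCompact.nonempty_iInter_of_directed_nonempty_isCompact_isClosed
      (fun P : {P : Submodule R W // IsOpen (P : Set W)} => {w : W | P.1.mkQ w = f P x})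
      ?_ ?_ ?_ ?_
    · obtain ⟨w, hw⟩ := this
      exact ⟨w, fun P => Set.mem_iInter.1 hw P⟩
    · intro P Q
      refine ⟨⟨P.1 ⊓ Q.1, P.2.inter Q.2⟩, ?_, ?_⟩
      · intro w hw
        change P.1.mkQ w = f P x
        rw [← compat ⟨P.1 ⊓ Q.1, P.2.inter Q.2⟩ P inf_le_left, ← show _ = _ from hw]
        rfl
      · intro w hw
        change Q.1.mkQ w = f Q x
        rw [← compat ⟨P.1 ⊓ Q.1, P.2.inter Q.2⟩ Q inf_le_right, ← show _ = _ from hw]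
        rfl
    · intro P
      exact P.1.mkQ_surjective (f P x)
    · intro P
      have := W.discreteTopology_quotient_of_isOpen P.2
      exact (isClosed_discrete {f P x}).preimage P.1.continuous_mkQ |>.isCompact
    · intro P
      have := W.discreteTopology_quotient_of_isOpen P.2
      exact (isClosed_discrete {f P x}).preimage P.1.continuous_mkQ
  choose F hF using hex
  have huniq : ∀ w w' : W, (∀ P : {P : Submodule R W // IsOpen (P : Set W)},
      P.1.mkQ w = P.1.mkQ w') → w = w' := fun w w' h =>
    sub_eq_zero.1 (W.eq_zero_of_forall_isOpen_mem fun P hP =>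
      (Submodule.Quotient.eq P).1 (h ⟨P, hP⟩))
  refine ⟨{ toFun := F, map_add' := ?_, map_smul' := ?_, cont := ?_ }, fun P x => hF x P⟩
  · exact fun x y => huniq _ _ fun P => by rw [hF, map_add, map_add, hF, hF]
  · exact fun r x => huniq _ _ fun P => by
      rw [hF, map_smul, RingHom.id_apply, map_smul, hF]
  · refine continuous_iff_continuousAt.2 fun x => ?_
    intro O hO
    obtain ⟨O', hO'O, hO', hx⟩ := mem_nhds_iff.1 hO
    obtain ⟨P, hP, hPO⟩ := W.exists_isOpen_submodule_subset
      (O := {w | w + F x ∈ O'}) (hO'.preimage (continuous_id.add continuous_const))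
      (by simpa using hx)
    have := W.discreteTopology_quotient_of_isOpen hP
    have hev : ∀ᶠ y in nhds x, f ⟨P, hP⟩ y = f ⟨P, hP⟩ x :=
      ((f ⟨P, hP⟩).continuous.tendsto x).eventually ((isOpen_discrete {_}).mem_nhds rfl)
    refine Filter.mem_map.2 (hev.mono fun y hy => hO'O ?_)
    rw [← hF y, ← hF x] at hy
    have hmem : F y - F x + F x ∈ O' := hPO ((Submodule.Quotient.eq P).1 hy)
    rwa [sub_add_cancel] at hmem

/-- A homomorphism out of a finitely generated module into a finite module is determined by
finitely many values, so there are only finitely many. -/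
theorem finite_continuousLinearMap {U : ProfiniteModule R} (hU : Module.Finite R U)
    {T : Type*} [AddCommGroup T] [TopologicalSpace T] [Module R T] [Finite T] :
    Finite (U →L[R] T) := by
  obtain ⟨s, hs⟩ := hU.fg_top
  refine Finite.of_injective (fun f : U →L[R] T => fun x : s => f x) fun f g h => ?_
  refine ContinuousLinearMap.coe_injective (LinearMap.ext_on hs fun x hx => ?_)
  exact congrFun h ⟨x, hx⟩

/-- For finitely generated `U`, a homomorphism `U → W` lifts through `β : V → W` as soon as it
lifts modulo every open submodule of `V`: the lifts modulo `P` form an inverse system of nonempty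
finite sets. -/
theorem exists_lift_of_forall_isOpen [CompactSpace R] {U V W : ProfiniteModule R}
    (hU : Module.Finite R U) (φ : U →L[R] W) (β : V →L[R] W)
    (h : ∀ P : Submodule R V, IsOpen (P : Set V) →
      ∃ ρ : U →L[R] V ⧸ P, ∀ u, ∃ v, P.mkQ v = ρ u ∧ β v = φ u) :
    ∃ ρ : U →L[R] V, β.comp ρ = φ := by
  let J := {P : Submodule R V // IsOpen (P : Set V)}ᵒᵈ
  let S : J → Type u := fun P => {ρ : U →L[R] V ⧸ (OrderDual.ofDual P).1 //
    ∀ u, ∃ v, (OrderDual.ofDual P).1.mkQ v = ρ u ∧ β v = φ u}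
  have hS (P : J) : Nonempty (S P) :=
    (h _ (OrderDual.ofDual P).2).elim fun ρ hρ => ⟨⟨ρ, hρ⟩⟩
  have hfin (P : J) : Finite (S P) := by
    have := V.finite_quotient_of_isOpen (OrderDual.ofDual P).2
    have := finite_continuousLinearMap (T := V ⧸ (OrderDual.ofDual P).1) hU
    exact Subtype.finite
  have hdir : IsDirected J (· ≤ ·) := ⟨fun P Q => ⟨OrderDual.toDual
    ⟨(OrderDual.ofDual P).1 ⊓ (OrderDual.ofDual Q).1,
      (OrderDual.ofDual P).2.inter (OrderDual.ofDual Q).2⟩,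
    (inf_le_left : (OrderDual.ofDual P).1 ⊓ (OrderDual.ofDual Q).1 ≤ _),
    (inf_le_right : (OrderDual.ofDual P).1 ⊓ (OrderDual.ofDual Q).1 ≤ _)⟩⟩
  let tr : ∀ {P Q : J}, P ≤ Q → S Q → S P := fun {P Q} hPQ ρ =>
    have hle : (OrderDual.ofDual Q).1 ≤ (OrderDual.ofDual P).1 := hPQ
    have := V.discreteTopology_quotient_of_isOpen (OrderDual.ofDual Q).2
    ⟨{ toLinearMap := (Submodule.factor hle).comp ρ.1.toLinearMap
       cont := (continuous_of_discreteTopology (f := Submodule.factor hle)).comp ρ.1.continuous },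
      fun u => (ρ.2 u).imp fun v hv => ⟨by
        change _ = Submodule.factor hle (ρ.1 u)
        rw [← hv.1]; rfl, hv.2⟩⟩
  have htr {P Q : J} (hPQ : P ≤ Q) (ρ : S Q) (u : U) :
      (tr hPQ ρ).1 u = Submodule.factor (show (OrderDual.ofDual Q).1 ≤ (OrderDual.ofDual P).1
        from hPQ) (ρ.1 u) := rfl
  let F : CategoryTheory.Functor (Opposite J) (Type u) :=
    { obj := fun P => S P.unop
      map := fun {P Q} f => TypeCat.ofHom (tr (CategoryTheory.leOfHom f.unop))
      map_id := fun P => by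
        ext ρ u
        refine (htr _ ρ u).trans ?_
        obtain ⟨v, hv⟩ := Submodule.mkQ_surjective _ (ρ.1 u)
        rw [← hv]
        exact hv
      map_comp := fun {P Q T} f g => by
        ext ρ u
        obtain ⟨v, hv⟩ := Submodule.mkQ_surjective _ (ρ.1 u)
        refine (htr _ ρ u).trans ?_
        change _ = Submodule.factor (show (OrderDual.ofDual Q.unop).1 ≤ (OrderDual.ofDual T.unop).1
          from CategoryTheory.leOfHom g.unop) (Submodule.factor
            (show (OrderDual.ofDual P.unop).1 ≤ (OrderDual.ofDual Q.unop).1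
              from CategoryTheory.leOfHom f.unop) (ρ.1 u))
        rw [← hv]
        rfl }
  have : ∀ j, Finite (F.obj j) := fun j => hfin j.unop
  have : ∀ j, Nonempty (F.obj j) := fun j => hS j.unop
  obtain ⟨s, hs⟩ := nonempty_sections_of_finite_inverse_system F
  obtain ⟨ρ, hρ⟩ := V.exists_of_compatible
    (fun P => (show S (OrderDual.toDual P) from s (Opposite.op (OrderDual.toDual P))).1)
    (fun P Q hPQ x => by
      have hle : (OrderDual.toDual Q : J) ≤ OrderDual.toDual P := hPQ
      have := hs (CategoryTheory.homOfLE hle).op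
      exact congrArg (fun t : S (OrderDual.toDual Q) => t.1 x) this)
  refine ⟨ρ, ContinuousLinearMap.ext fun u => ?_⟩
  -- `ρ u` lies in the closed set `β ⁻¹ (φ u)`, since every coset `ρ u + P` meets it.
  have hcl : IsClosed {v : V | β v = φ u} := isClosed_eq β.continuous continuous_const
  change ρ u ∈ {v : V | β v = φ u}
  by_contra hne
  obtain ⟨P, hP, hPO⟩ := V.exists_isOpen_submodule_subset
    (O := {v | v + ρ u ∈ {v : V | β v = φ u}ᶜ})
    (hcl.isOpen_compl.preimage (continuous_id.add continuous_const)) (by simpa using hne)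
  obtain ⟨v, hv, hvφ⟩ :=
    (show S (OrderDual.toDual ⟨P, hP⟩) from s (Opposite.op (OrderDual.toDual ⟨P, hP⟩))).2 u
  have hmem : v - ρ u + ρ u ∈ {v : V | β v = φ u}ᶜ :=
    hPO ((Submodule.Quotient.eq P).1 (hv.trans (hρ ⟨P, hP⟩ u).symm))
  rw [sub_add_cancel] at hmem
  exact hmem hvφ

end OpenSubmodules
end ProfiniteModule

/-! ### The universal property of the completed tensor product -/

namespace ProfiniteModule

section TensorHom

variable {R S : Type u} [Ring R] [TopologicalSpace R] [Ring S] [TopologicalSpace S]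

open scoped TensorProduct in
/-- The homomorphism `R ⊗_S V → W`, `r ⊗ v ↦ r • g v`, on the abstract tensor product. -/
noncomputable def abstractLift (φ : S →+* R) (V : ProfiniteModule S) {W : ProfiniteModule R}
    (g : V →+ W) (hg : ∀ (s : S) (v : V), g (s • v) = φ s • g v) :
    AbstractTensor φ V →ₗ[R] W :=
  Submodule.liftQ _ (TensorProduct.AlgebraTensorModule.lift
    (LinearMap.toSpanSingleton R (V →ₗ[ℤ] W) g.toIntLinearMap)) (by
      rw [Submodule.span_le]
      rintro _ ⟨r, s, v, rfl⟩
      simp [hg, mul_smul])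

theorem abstractLift_pureTensor (φ : S →+* R) (V : ProfiniteModule S) {W : ProfiniteModule R}
    (g : V →+ W) (hg : ∀ (s : S) (v : V), g (s • v) = φ s • g v) (r : R) (v : V) :
    abstractLift φ V g hg (pureTensor φ V r v) = r • g v := by
  simp [abstractLift, pureTensor]

/-- The preimage of an open submodule under `r ⊗ v ↦ r • g v`. -/
noncomputable def OpenTensorSubmodule.comap (φ : S →+* R) (V : ProfiniteModule S)
    {W : ProfiniteModule R} (g : V →+ W) (hg : ∀ (s : S) (v : V), g (s • v) = φ s • g v)
    (hc : Continuous g) (P : Submodule R W) (hP : IsOpen (P : Set W)) :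
    OpenTensorSubmodule φ V where
  ker := P.comap (abstractLift φ V g hg)
  finite := by
    have := W.finite_quotient_of_isOpen hP
    refine Finite.of_injective (Submodule.mapQ _ P (abstractLift φ V g hg) le_rfl) ?_
    rw [← LinearMap.ker_eq_bot, Submodule.ker_mapQ, ← le_bot_iff, Submodule.map_le_iff_le_comap,
      Submodule.comap_bot, Submodule.ker_mkQ]
  locallyConstant := by
    refine (IsLocallyConstant.iff_eventually_eq _).2 ?_
    rintro ⟨r, v⟩
    have hcont : Continuous fun p : R × V => p.1 • g p.2 - r • g v :=
      (continuous_fst.smul (hc.comp continuous_snd)).sub continuous_const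
    refine ((hcont.tendsto (r, v)).eventually (hP.mem_nhds (by simp))).mono fun p hp => ?_
    refine (Submodule.Quotient.eq _).2 ?_
    rw [Submodule.mem_comap, map_sub, abstractLift_pureTensor, abstractLift_pureTensor]
    exact hp

variable [IsTopologicalRing R]

theorem completedPureTensor_add (φ : S →+* R) (V : ProfiniteModule S) (r : R) (v w : V) :
    completedPureTensor φ V r (v + w) =
      completedPureTensor φ V r v + completedPureTensor φ V r w := by
  refine Subtype.ext (funext fun K => ?_)
  change K.mkQ _ = K.mkQ _ + K.mkQ _
  rw [← map_add, pureTensor, TensorProduct.tmul_add]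
  rfl

theorem smul_completedPureTensor (φ : S →+* R) (V : ProfiniteModule S) (a r : R) (v : V) :
    a • completedPureTensor φ V r v = completedPureTensor φ V (a * r) v := by
  refine Subtype.ext (funext fun K => ?_)
  change a • K.mkQ _ = K.mkQ _
  rw [← map_smul, smul_pureTensor]

theorem completedPureTensor_balanced (φ : S →+* R) (V : ProfiniteModule S) (r : R) (s : S)
    (v : V) :
    completedPureTensor φ V (r * φ s) v = completedPureTensor φ V r (s • v) := by
  refine Subtype.ext (funext fun K => ?_)
  change K.mkQ _ = K.mkQ _
  rw [pureTensor_balanced]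

theorem continuous_completedPureTensor (φ : S →+* R) (V : ProfiniteModule S) :
    Continuous fun p : R × V => completedPureTensor φ V p.1 p.2 :=
  Continuous.subtype_mk (continuous_pi fun K => K.continuous_mkQ_pureTensor) _

/-- The pure tensors generate a dense subgroup of `R ⊗̂_S V`. -/
theorem completedTensor_induction (φ : S →+* R) (V : ProfiniteModule S)
    (C : Set (completedTensor φ V)) (hC : IsClosed C) (h0 : 0 ∈ C)
    (hadd : ∀ x ∈ C, ∀ y ∈ C, x + y ∈ C) (hp : ∀ r v, completedPureTensor φ V r v ∈ C)
    (x : completedTensor φ V) : x ∈ C := by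
  have key (t : AbstractTensor φ V) : ∃ y ∈ C, ∀ K : OpenTensorSubmodule φ V,
      y.1 K = K.mkQ t := by
    induction t using abstractTensor_induction with
    | h0 => exact ⟨0, h0, fun K => (map_zero K.mkQ).symm⟩
    | hadd a b ha hb =>
      obtain ⟨y, hy, hya⟩ := ha
      obtain ⟨z, hz, hzb⟩ := hb
      refine ⟨y + z, hadd _ hy _ hz, fun K => ?_⟩
      rw [map_add, ← hya, ← hzb]
      rfl
    | hp r v => exact ⟨_, hp r v, fun K => rfl⟩
  -- Finitely many open submodules contain a common one, so a single coordinate controls a basic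
  -- neighbourhood.
  have hinf (I : Finset (OpenTensorSubmodule φ V)) :
      ∃ K : OpenTensorSubmodule φ V, ∀ L ∈ I, K.ker ≤ L.ker := by
    have hdir : Nonempty (OpenTensorSubmodule φ V) :=
      ⟨⟨⊤, inferInstance, (IsLocallyConstant.iff_eventually_eq _).2 fun _ =>
        Filter.Eventually.of_forall fun _ => Subsingleton.elim _ _⟩⟩
    have hfi := fun L : OpenTensorSubmodule φ V => L.finite
    classical
    induction I using Finset.induction_on with
    | empty => exact ⟨hdir.some, by simp⟩
    | insert L I _ ih =>
      obtain ⟨K, hK⟩ := ih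
      refine ⟨⟨K.ker ⊓ L.ker, ?_, ?_⟩, ?_⟩
      · refine Finite.of_injective (fun q : AbstractTensor φ V ⧸ (K.ker ⊓ L.ker) =>
          ((Submodule.factor inf_le_left q : AbstractTensor φ V ⧸ K.ker),
            (Submodule.factor inf_le_right q : AbstractTensor φ V ⧸ L.ker))) ?_
        intro p q hpq
        obtain ⟨p, rfl⟩ := Submodule.mkQ_surjective _ p
        obtain ⟨q, rfl⟩ := Submodule.mkQ_surjective _ q
        obtain ⟨h1, h2⟩ := Prod.ext_iff.1 hpq
        exact (Submodule.Quotient.eq _).2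
          ⟨(Submodule.Quotient.eq _).1 h1, (Submodule.Quotient.eq _).1 h2⟩
      · refine (IsLocallyConstant.iff_eventually_eq _).2 fun p => ?_
        filter_upwards [(IsLocallyConstant.iff_eventually_eq _).1 K.locallyConstant p,
          (IsLocallyConstant.iff_eventually_eq _).1 L.locallyConstant p] with q h1 h2
        exact (Submodule.Quotient.eq _).2
          ⟨(Submodule.Quotient.eq _).1 h1, (Submodule.Quotient.eq _).1 h2⟩
      · intro L' hL'
        rcases Finset.mem_insert.1 hL' with rfl | hL'
        · exact inf_le_right
        · exact inf_le_left.trans (hK L' hL')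
  rw [← hC.closure_eq, mem_closure_iff]
  intro O hO hx
  obtain ⟨O', hO', rfl⟩ := isOpen_induced_iff.1 hO
  obtain ⟨I, t, ht, hsub⟩ := isOpen_pi_iff.1 hO' _ hx
  obtain ⟨K, hK⟩ := hinf I
  obtain ⟨a, ha⟩ := K.mkQ_surjective (x.1 K)
  obtain ⟨y, hy, hya⟩ := key a
  refine ⟨y, hsub fun L hL => ?_, hy⟩
  have : y.1 L = x.1 L := by
    rw [hya, ← x.2 K L (hK L hL), ← ha]
    rfl
  rw [this]
  exact (ht L hL).2

/-- Homomorphisms out of `R ⊗̂_S V` are determined by their values on the tensors `1 ⊗ v`. -/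
theorem completedTensor_hom_ext (φ : S →+* R) (V : ProfiniteModule S) {W : ProfiniteModule R}
    {f g : completedTensor φ V →L[R] W}
    (h : ∀ v, f (completedPureTensor φ V 1 v) = g (completedPureTensor φ V 1 v)) : f = g := by
  refine ContinuousLinearMap.ext fun x => completedTensor_induction φ V {x | f x = g x}
    (isClosed_eq f.continuous g.continuous) ?_ ?_ ?_ x
  · exact (map_zero f).trans (map_zero g).symm
  · intro x hx y hy
    change f (x + y) = g (x + y)
    rw [map_add, map_add, show f x = g x from hx, show f y = g y from hy]
  · intro r v
    change f _ = g _
    rw [← mul_one r, ← smul_completedPureTensor, map_smul, map_smul, h]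

/-- The universal property of `R ⊗̂_S V`: a continuous `S`-homomorphism `g` from `V` to an
`R`-module `W` extends to a continuous `R`-homomorphism `r ⊗ v ↦ r • g v`. -/
theorem exists_completedTensor_lift [CompactSpace R] (φ : S →+* R) (V : ProfiniteModule S)
    {W : ProfiniteModule R} (g : V →+ W) (hg : ∀ (s : S) (v : V), g (s • v) = φ s • g v)
    (hc : Continuous g) :
    ∃ f : completedTensor φ V →L[R] W,
      ∀ r v, f (completedPureTensor φ V r v) = r • g v := by
  let K (P : {P : Submodule R W // IsOpen (P : Set W)}) : OpenTensorSubmodule φ V :=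
    OpenTensorSubmodule.comap φ V g hg hc P.1 P.2
  let d (P : {P : Submodule R W // IsOpen (P : Set W)}) : (K P).Quot →ₗ[R] W ⧸ P.1 :=
    Submodule.mapQ _ P.1 (abstractLift φ V g hg) le_rfl
  have hd (P) (t : AbstractTensor φ V) :
      d P ((K P).mkQ t) = P.1.mkQ (abstractLift φ V g hg t) := rfl
  obtain ⟨f, hf⟩ := W.exists_of_compatible (T := completedTensor φ V)
    (fun P =>
      { toFun := fun x => d P (x.1 (K P))
        map_add' := fun x y => map_add (d P) (x.1 (K P)) (y.1 (K P))
        map_smul' := fun r x => map_smul (d P) r (x.1 (K P))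
        cont := (continuous_of_discreteTopology (f := d P)).comp
          ((continuous_apply (K P)).comp continuous_subtype_val) })
    (fun P Q hPQ x => by
      change Submodule.factor hPQ (d P (x.1 (K P))) = d Q (x.1 (K Q))
      rw [← x.2 (K P) (K Q) (Submodule.comap_mono hPQ)]
      obtain ⟨t, ht⟩ := (K P).mkQ_surjective (x.1 (K P))
      rw [← ht]
      rfl)
  refine ⟨f, fun r v => ?_⟩
  refine sub_eq_zero.1 (W.eq_zero_of_forall_isOpen_mem fun P hP =>
    (Submodule.Quotient.eq P).1 ((hf ⟨P, hP⟩ _).trans ?_))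
  change d ⟨P, hP⟩ ((K ⟨P, hP⟩).mkQ _) = _
  rw [hd, abstractLift_pureTensor]
  rfl

end TensorHom
end ProfiniteModule

/-! ### Relative projectivity and induced modules -/

namespace ProfiniteModule

section RelativelyProjective

variable {k G : Type u} [Field k] [Group G] [TopologicalSpace G]

/-- A continuous additive map between `k[[G]]`-modules commuting with the actions of `k` and of
the subgroup `L`, as a homomorphism of `k[[L]]`-modules. -/
noncomputable def resHomOfCommutes (L : Subgroup G)
    {U W : ProfiniteModule (CompletedGroupAlgebra k G)} (f : U → W) (hf : Continuous f)
    (hadd : ∀ u v, f (u + v) = f u + f v)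
    (hof : ∀ g ∈ L, ∀ u, f (CompletedGroupAlgebra.of k g • u) = CompletedGroupAlgebra.of k g • f u)
    (hk : ∀ (c : k) u, f (algebraMap k (CompletedGroupAlgebra k G) c • u) =
      algebraMap k (CompletedGroupAlgebra k G) c • f u) :
    res L U →L[CompletedGroupAlgebra k L] res L W where
  toFun := f
  map_add' := hadd
  map_smul' r u := map_smul_of_commutes (U := res L U) (W := res L W) (f := f) hf hadd
    (fun g u => by
      change f (CompletedGroupAlgebra.incl k L (CompletedGroupAlgebra.of k g) • (show U from u)) =
        CompletedGroupAlgebra.incl k L (CompletedGroupAlgebra.of k g) • f u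
      rw [CompletedGroupAlgebra.incl_of]
      exact hof g g.2 u)
    (fun c u => by
      change f (CompletedGroupAlgebra.incl k L (algebraMap k _ c) • (show U from u)) =
        CompletedGroupAlgebra.incl k L (algebraMap k _ c) • f u
      rw [AlgHom.commutes]
      exact hk c u) r u
  cont := hf

theorem resHom_comp_eq_iff (L : Subgroup G)
    {U V W : ProfiniteModule (CompletedGroupAlgebra k G)}
    (β : V →L[CompletedGroupAlgebra k G] W) (φ : U →L[CompletedGroupAlgebra k G] W)
    (σ : res L U →L[CompletedGroupAlgebra k L] res L V) :
    (resHom L β).comp σ = resHom L φ ↔ ∀ u : U, β (resFun L σ u) = φ u :=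
  ⟨fun h u => DFunLike.congr_fun h u, fun h => ContinuousLinearMap.ext h⟩

/-- Relative projectivity passes to larger subgroups, as homomorphisms over the larger subgroup
are homomorphisms over the smaller one. -/
theorem IsRelativelyProjective.mono {H L : Subgroup G} (hHL : H ≤ L)
    {U : ProfiniteModule (CompletedGroupAlgebra k G)} (hU : U.IsRelativelyProjective H) :
    U.IsRelativelyProjective L := by
  rintro V W φ β hβ ⟨σ, hσ⟩
  rw [resHom_comp_eq_iff] at hσ
  refine hU V W φ β hβ ⟨resHomOfCommutes H (resFun L σ) (continuous_resFun L σ) (resFun_add L σ)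
    (fun g hg u => map_of_smul L σ ⟨g, hHL hg⟩ u) (map_algebraMap_smul L σ), ?_⟩
  rw [resHom_comp_eq_iff]
  exact hσ

theorem IsRelativelyProjective.splits {H : Subgroup G}
    {U V : ProfiniteModule (CompletedGroupAlgebra k G)} (hU : U.IsRelativelyProjective H)
    (β : V →L[CompletedGroupAlgebra k G] U) (hβ : Function.Surjective β)
    (h : Splits (resHom H β)) : Splits β :=
  hU V U (ContinuousLinearMap.id _ U) β hβ h

theorem IsRelativelyProjective.of_isSummand {H : Subgroup G}
    {U W : ProfiniteModule (CompletedGroupAlgebra k G)} (hW : W.IsRelativelyProjective H)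
    (h : U.IsSummand W) : U.IsRelativelyProjective H := by
  obtain ⟨i, π, hiπ⟩ := h
  rintro A B φ β hβ ⟨σ, hσ⟩
  obtain ⟨ρ, hρ⟩ := hW A B (φ.comp π) β hβ ⟨σ.comp (resHom H π), by
    rw [← ContinuousLinearMap.comp_assoc, hσ]
    rfl⟩
  exact ⟨ρ.comp i, by
    rw [← ContinuousLinearMap.comp_assoc, hρ, ContinuousLinearMap.comp_assoc, hiπ,
      ContinuousLinearMap.comp_id]⟩

variable [Finite k] [IsTopologicalGroup G] [CompactSpace G]

/-- Induced modules are relatively projective: a `k[[H]]`-lift restricted to `1 ⊗ V` extends to a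
`k[[G]]`-lift by the universal property. -/
theorem isRelativelyProjective_ind (H : Subgroup G)
    (V : ProfiniteModule (CompletedGroupAlgebra k H)) :
    (ind H V).IsRelativelyProjective H := by
  rintro A B φ β hβ ⟨σ, hσ⟩
  rw [resHom_comp_eq_iff] at hσ
  let ι : V → ind H V := completedPureTensor (CompletedGroupAlgebra.inclRingHom k H) V 1
  have hι (s : CompletedGroupAlgebra k H) (v : V) :
      ι (s • v) = CompletedGroupAlgebra.incl k H s • ι v := by
    refine (completedPureTensor_balanced (CompletedGroupAlgebra.inclRingHom k H) V 1 s v).symm.trans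
      (Eq.trans ?_ (smul_completedPureTensor (CompletedGroupAlgebra.inclRingHom k H) V
        (CompletedGroupAlgebra.inclRingHom k H s) 1 v).symm)
    rw [one_mul, mul_one]
  obtain ⟨ρ, hρ⟩ := exists_completedTensor_lift (CompletedGroupAlgebra.inclRingHom k H) V
    (W := A)
    (AddMonoidHom.mk' (fun v => resFun H σ (ι v)) fun v w =>
      (congrArg (resFun H σ) (completedPureTensor_add _ V 1 v w)).trans (resFun_add H σ _ _))
    (fun s v => (congrArg (resFun H σ) (hι s v)).trans (resFun_smul H σ s (ι v)))
    ((continuous_resFun H σ).comp ((continuous_completedPureTensor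
      (CompletedGroupAlgebra.inclRingHom k H) V).comp (continuous_const.prodMk continuous_id)))
  refine ⟨ρ, completedTensor_hom_ext _ V fun v => ?_⟩
  exact (congrArg β ((hρ 1 v).trans (one_smul _ _))).trans (hσ (ι v))

/-- The counit `U↓_H↑^G → U` is an epimorphism split over `k[[H]]` by `u ↦ 1 ⊗ u`; a splitting
over `k[[G]]` exhibits `U` as a summand. -/
theorem isSummand_ind_res_of_splits (H : Subgroup G)
    (U : ProfiniteModule (CompletedGroupAlgebra k G))
    (hU : ∀ (V : ProfiniteModule.{u} (CompletedGroupAlgebra k G))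
      (β : V →L[CompletedGroupAlgebra k G] U), Function.Surjective β →
        Splits (resHom H β) → Splits β) :
    U.IsSummand (ind H (res H U)) := by
  obtain ⟨ε, hε⟩ := exists_completedTensor_lift (CompletedGroupAlgebra.inclRingHom k H) (res H U)
    (W := U) (AddMonoidHom.id U) (fun _ _ => rfl) continuous_id
  have hε1 (u : U) : ε (completedPureTensor (CompletedGroupAlgebra.inclRingHom k H)
      (res H U) 1 u) = u := (hε 1 u).trans (one_smul _ u)
  obtain ⟨i, hi⟩ := hU (ind H (res H U)) ε (fun u => ⟨_, hε1 u⟩)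
    ⟨{ toFun := fun u => completedPureTensor (CompletedGroupAlgebra.inclRingHom k H)
          (res H U) 1 u
       map_add' := completedPureTensor_add _ (res H U) 1
       map_smul' := fun s u =>
        (completedPureTensor_balanced (CompletedGroupAlgebra.inclRingHom k H) (res H U)
          1 s u).symm.trans (Eq.trans (by rw [one_mul, mul_one])
            (smul_completedPureTensor (CompletedGroupAlgebra.inclRingHom k H) (res H U)
              (CompletedGroupAlgebra.inclRingHom k H s) 1 u).symm)
       cont := (continuous_completedPureTensor (CompletedGroupAlgebra.inclRingHom k H)
          (res H U)).comp (continuous_const.prodMk continuous_id) },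
      ContinuousLinearMap.ext hε1⟩
  exact ⟨i, ε, hi⟩

end RelativelyProjective
end ProfiniteModule

/-! ### Quotients and coinvariants -/

namespace ProfiniteModule

section Quotients

variable {R : Type u} [Ring R] [TopologicalSpace R]

/-- The projection of a profinite module onto its quotient by a closed submodule. -/
def quotientMk (U : ProfiniteModule R) (C : Submodule R U) (hC : IsClosed (C : Set U)) :
    U →L[R] U.quotient C hC where
  toLinearMap := C.mkQ
  cont := C.continuous_mkQ

theorem quotientMk_surjective (U : ProfiniteModule R) (C : Submodule R U)
    (hC : IsClosed (C : Set U)) : Function.Surjective (U.quotientMk C hC) :=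
  C.mkQ_surjective

theorem quotientMk_eq_iff {U : ProfiniteModule R} {C : Submodule R U}
    {hC : IsClosed (C : Set U)} {u v : U} :
    U.quotientMk C hC u = U.quotientMk C hC v ↔ u - v ∈ C :=
  Submodule.Quotient.eq C

/-- A continuous function constant on the cosets of `C` descends to the quotient by `C`. It is not
assumed to be linear, as it may be linear over a smaller ring only. -/
theorem exists_continuous_desc (U : ProfiniteModule R) (C : Submodule R U)
    (hC : IsClosed (C : Set U)) {T : Type*} [TopologicalSpace T] (f : U → T) (hf : Continuous f)
    (h : ∀ u v, u - v ∈ C → f u = f v) :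
    ∃ F : U.quotient C hC → T, Continuous F ∧ ∀ u, F (U.quotientMk C hC u) = f u :=
  ⟨Quotient.lift f fun u v huv => h u v (C.quotientRel_def.1 huv), hf.quotient_lift _,
    fun _ => rfl⟩

theorem exists_hom_desc (U : ProfiniteModule R) (C : Submodule R U)
    (hC : IsClosed (C : Set U)) {W : ProfiniteModule R} (f : U →L[R] W)
    (h : ∀ u ∈ C, f u = 0) :
    ∃ F : U.quotient C hC →L[R] W, F.comp (U.quotientMk C hC) = f := by
  obtain ⟨F, hF, hFf⟩ := U.exists_continuous_desc C hC f f.continuous fun u v huv => by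
    rw [← sub_eq_zero, ← map_sub, h _ huv]
  refine ⟨{ toFun := F, map_add' := ?_, map_smul' := ?_, cont := hF },
    ContinuousLinearMap.ext hFf⟩
  · intro x y
    obtain ⟨x, rfl⟩ := U.quotientMk_surjective C hC x
    obtain ⟨y, rfl⟩ := U.quotientMk_surjective C hC y
    rw [← map_add, hFf, hFf, hFf, map_add]
  · intro r x
    obtain ⟨x, rfl⟩ := U.quotientMk_surjective C hC x
    rw [← map_smul, hFf, hFf, map_smul, RingHom.id_apply]

end Quotients

section Coinvariants

variable {k G : Type u} [Field k] [Group G] [TopologicalSpace G]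

/-- The projection of a module onto its coinvariants. -/
noncomputable def coinvariantsMk (N : Subgroup G) [N.Normal]
    (U : ProfiniteModule (CompletedGroupAlgebra k G)) :
    U →L[CompletedGroupAlgebra k G] coinvariants N U :=
  U.quotientMk (augmentation N U) (Submodule.isClosed_topologicalClosure _)

theorem of_smul_sub_mem_augmentation {N : Subgroup G}
    (U : ProfiniteModule (CompletedGroupAlgebra k G)) {n : G} (hn : n ∈ N) (u : U) :
    CompletedGroupAlgebra.of k n • u - u ∈ augmentation N U :=
  Submodule.le_topologicalClosure _ (Submodule.subset_span ⟨n, hn, u, rfl⟩)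

/-- The augmentation submodule is contained in every closed submodule modulo which `N` acts
trivially. -/
theorem augmentation_le {N : Subgroup G} {U : ProfiniteModule (CompletedGroupAlgebra k G)}
    {C : Submodule (CompletedGroupAlgebra k G) U} (hC : IsClosed (C : Set U))
    (h : ∀ n ∈ N, ∀ u : U, CompletedGroupAlgebra.of k n • u - u ∈ C) : augmentation N U ≤ C := by
  refine Submodule.topologicalClosure_minimal _ (Submodule.span_le.2 ?_) hC
  rintro _ ⟨n, hn, u, rfl⟩
  exact h n hn u

theorem of_smul_coinvariants {N : Subgroup G} [N.Normal]
    (U : ProfiniteModule (CompletedGroupAlgebra k G)) {n : G} (hn : n ∈ N)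
    (x : coinvariants N U) : CompletedGroupAlgebra.of k n • x = x := by
  obtain ⟨u, rfl⟩ := U.quotientMk_surjective _ _ x
  refine (map_smul (U.quotientMk _ _) (CompletedGroupAlgebra.of k n) u).symm.trans ?_
  exact quotientMk_eq_iff.2 (U.of_smul_sub_mem_augmentation hn u)

/-- The trace as a sum with respect to an arbitrary enumeration of `G/L`. -/
theorem trace_apply [IsTopologicalGroup G] [CompactSpace G]
    {U W : ProfiniteModule (CompletedGroupAlgebra k G)} (L : Subgroup G)
    (hL : IsOpen (L : Set G)) [Fintype (G ⧸ L)]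
    (α : res L U →L[CompletedGroupAlgebra k L] res L W) (u : U) :
    trace L hL α u = ∑ s : G ⧸ L, cosetConj L α u s := by
  change @Finset.sum _ _ _ (@Finset.univ _ (_)) _ = _
  congr!

/-- If the identity of `U` is a trace from the open subgroup `L ⊇ N`, then `U_N` is relatively
`L`-projective. A lift `σ` over `L` is averaged to the trace of `σ π α`, where `π` is the
projection to coinvariants; as `N` acts trivially on the image of `σ`, the result factors
through `π`. -/
theorem isRelativelyProjective_coinvariants_of_trace [IsTopologicalGroup G] [CompactSpace G]
    (N L : Subgroup G) [N.Normal] (hNL : N ≤ L) (hL : IsOpen (L : Set G))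
    (U : ProfiniteModule (CompletedGroupAlgebra k G))
    (α : res L U →L[CompletedGroupAlgebra k L] res L U)
    (hα : ContinuousLinearMap.id (CompletedGroupAlgebra k G) U = trace L hL α) :
    (coinvariants N U).IsRelativelyProjective L := by
  rintro V W φ β hβ ⟨σ, hσ⟩
  rw [resHom_comp_eq_iff] at hσ
  have : Finite (G ⧸ L) := Subgroup.quotient_finite_of_isOpen L hL
  let : Fintype (G ⧸ L) := Fintype.ofFinite _
  let π := coinvariantsMk N U
  let γ : res L U →L[CompletedGroupAlgebra k L] res L V := (σ.comp (resHom L π)).comp α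
  have hγ (u : U) : resFun L γ u = resFun L σ (π (resFun L α u)) := rfl
  have hβγ (u : U) (s : G ⧸ L) : β (cosetConj L γ u s) = φ (π (cosetConj L α u s)) := by
    obtain ⟨s, rfl⟩ := QuotientGroup.mk_surjective s
    rw [cosetConj_mk, cosetConj_mk, conj, conj, map_smul, hγ, hσ, map_smul, map_smul]
  -- `γ` is invariant under `N`, because `N` acts trivially on `U_N`.
  have hγN (u : U) {n : G} (hn : n ∈ N) :
      resFun L γ (CompletedGroupAlgebra.of k n • u) = resFun L γ u := by
    rw [hγ, hγ, map_of_smul L α ⟨n, hNL hn⟩, map_smul]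
    exact congrArg (resFun L σ) (U.of_smul_coinvariants hn _)
  have htr (u : U) {n : G} (hn : n ∈ N) :
      trace L hL γ (CompletedGroupAlgebra.of k n • u) = trace L hL γ u := by
    rw [trace_apply, trace_apply]
    refine Finset.sum_congr rfl fun s _ => ?_
    obtain ⟨s, rfl⟩ := QuotientGroup.mk_surjective s
    rw [cosetConj_mk, cosetConj_mk, conj, conj, ← mul_smul, ← map_mul,
      show s⁻¹ * n = s⁻¹ * n * s⁻¹⁻¹ * s⁻¹ by group, map_mul, mul_smul,
      hγN _ (Subgroup.Normal.conj_mem inferInstance n hn s⁻¹)]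
  have hker : augmentation N U ≤ LinearMap.ker (trace L hL γ).toLinearMap := by
    refine augmentation_le ?_ fun n hn u => ?_
    · exact isClosed_singleton.preimage (trace L hL γ).continuous
    · rw [LinearMap.mem_ker, map_sub, sub_eq_zero]
      exact htr u hn
  obtain ⟨ρ, hρ⟩ := U.exists_hom_desc (augmentation N U)
    (Submodule.isClosed_topologicalClosure _) (trace L hL γ) fun u hu => hker hu
  refine ⟨ρ, ContinuousLinearMap.ext fun x => ?_⟩
  obtain ⟨u, rfl⟩ := U.quotientMk_surjective _ _ x
  have h1 : ρ (π u) = trace L hL γ u := DFunLike.congr_fun hρ u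
  have h2 : trace L hL α u = u := (DFunLike.congr_fun hα u).symm
  change β (ρ (π u)) = φ (π u)
  conv_rhs => rw [← h2]
  rw [h1, trace_apply, trace_apply, map_sum, map_sum, map_sum]
  exact Finset.sum_congr rfl fun s _ => hβγ u s

/-- Some open normal subgroup acts trivially on the quotient by a given open submodule. -/
theorem exists_openNormalSubgroup_smul_sub_mem [IsTopologicalGroup G] [CompactSpace G]
    [T2Space G] [TotallyDisconnectedSpace G]
    (V : ProfiniteModule (CompletedGroupAlgebra k G))
    {P : Submodule (CompletedGroupAlgebra k G) V} (hP : IsOpen (P : Set V)) :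
    ∃ N : OpenNormalSubgroup G, ∀ n ∈ N.toSubgroup, ∀ v : V,
      CompletedGroupAlgebra.of k n • v - v ∈ P := by
  have hev : ∀ᶠ g in nhds (1 : G), ∀ v ∈ (Set.univ : Set V),
      CompletedGroupAlgebra.of k g • v - v ∈ P := by
    refine isCompact_univ.eventually_forall_of_forall_eventually fun v _ => ?_
    have hc : Continuous fun p : G × V => CompletedGroupAlgebra.of k p.1 • p.2 - p.2 :=
      ((CompletedGroupAlgebra.continuous_of.comp continuous_fst).smul continuous_snd).sub
        continuous_snd
    exact (hc.tendsto (1, v)).eventually (hP.mem_nhds (by simp))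
  obtain ⟨O, hO, hOo, h1⟩ := mem_nhds_iff.1 hev
  obtain ⟨N, hN⟩ := ProfiniteGrp.exist_openNormalSubgroup_sub_open_nhds_of_one hOo h1
  exact ⟨N, fun n hn v => hO (hN hn) v trivial⟩

/-- A finitely generated `U` is relatively `H`-projective if its coinvariants `U_N` are relatively
`HN`-projective for all `N`. Modulo an open submodule `P` of `V`, a `k[[H]]`-lift `U → V` kills an
open submodule of `U`, hence for small `N` it factors through `U_N` and is `k[[HN]]`-linear. The
resulting `k[[G]]`-lifts modulo `P` are then glued by compactness. -/
theorem isRelativelyProjective_of_coinvariants [Finite k] [IsTopologicalGroup G] [CompactSpace G]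
    [T2Space G] [TotallyDisconnectedSpace G] (H : Subgroup G)
    (U : ProfiniteModule (CompletedGroupAlgebra k G))
    (hU : Module.Finite (CompletedGroupAlgebra k G) U)
    (h : ∀ N : OpenNormalSubgroup G,
      (coinvariants N.toSubgroup U).IsRelativelyProjective (H ⊔ N.toSubgroup)) :
    U.IsRelativelyProjective H := by
  rintro V W φ β hβ ⟨σ, hσ⟩
  rw [resHom_comp_eq_iff] at hσ
  refine exists_lift_of_forall_isOpen hU φ β fun P hP => ?_
  have hσ0 : resFun H σ 0 = 0 := map_zero σ
  have hσsub (u v : U) : resFun H σ (u - v) = resFun H σ u - resFun H σ v := map_sub σ u v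
  obtain ⟨U', hU', hU'P⟩ := U.exists_isOpen_submodule_subset
    (hP.preimage (continuous_resFun H σ)) (show resFun H σ 0 ∈ P from hσ0 ▸ P.zero_mem)
  -- `σ` maps `U'` into `P`; now take `N` acting trivially on both `U/U'` and `V/P`.
  obtain ⟨N₁, hN₁⟩ := U.exists_openNormalSubgroup_smul_sub_mem hU'
  obtain ⟨N₂, hN₂⟩ := V.exists_openNormalSubgroup_smul_sub_mem hP
  let N : OpenNormalSubgroup G := N₁ ⊓ N₂
  have hPc := V.isClosed_of_isOpen hP
  let C : Submodule (CompletedGroupAlgebra k G) W := P.map β.toLinearMap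
  have hC : IsClosed (C : Set W) := (hPc.isCompact.image β.continuous).isClosed
  let aug := augmentation N.toSubgroup U
  have hauc : IsClosed (aug : Set U) := Submodule.isClosed_topologicalClosure _
  have haug : aug ≤ U' := augmentation_le (U.isClosed_of_isOpen hU') fun n hn u => hN₁ n hn.1 u
  -- The lifting problem descends to `U_N`, `V/P` and `W/β(P)`, with `σ` inducing `f : U_N → V/P`.
  let πU := U.quotientMk aug hauc
  let πV := V.quotientMk P hPc
  let πW := W.quotientMk C hC
  have hπU : Function.Surjective πU := U.quotientMk_surjective aug hauc
  obtain ⟨β', hβ'⟩ := V.exists_hom_desc P hPc (πW.comp β) fun v hv =>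
    (quotientMk_eq_iff (hC := hC) (v := 0)).2
      (by rw [sub_zero]; exact ⟨v, hv, rfl⟩) |>.trans (map_zero πW)
  obtain ⟨φ', hφ'⟩ := U.exists_hom_desc aug hauc (πW.comp φ) fun u hu =>
    (quotientMk_eq_iff (hC := hC) (v := 0)).2
      (by rw [sub_zero]; exact ⟨_, hU'P (haug hu), hσ u⟩) |>.trans (map_zero πW)
  have hβ'v (v : V) : β' (πV v) = πW (β v) := DFunLike.congr_fun hβ' v
  have hφ'u (u : U) : φ' (πU u) = πW (φ u) := DFunLike.congr_fun hφ' u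
  obtain ⟨f, hf, hfσ⟩ := U.exists_continuous_desc aug hauc (fun u => πV (resFun H σ u))
    (πV.continuous.comp (continuous_resFun H σ)) fun u v huv => quotientMk_eq_iff.2 (by
      rw [← hσsub]
      exact hU'P (haug huv))
  have hfσ' (u : U) : f (πU u) = πV (resFun H σ u) := hfσ u
  have hNV {n : G} (hn : n ∈ N.toSubgroup) (y : V.quotient P hPc) :
      CompletedGroupAlgebra.of k n • y = y := by
    obtain ⟨v, rfl⟩ := V.quotientMk_surjective P hPc y
    rw [← map_smul]
    exact quotientMk_eq_iff.2 (hN₂ n hn.2 v)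
  let σ' : res (H ⊔ N.toSubgroup) (coinvariants N.toSubgroup U)
      →L[CompletedGroupAlgebra k (H ⊔ N.toSubgroup : Subgroup G)]
      res (H ⊔ N.toSubgroup) (V.quotient P hPc) :=
    resHomOfCommutes (H ⊔ N.toSubgroup) f hf
      (fun x y => by
        obtain ⟨x, rfl⟩ := hπU x
        obtain ⟨y, rfl⟩ := hπU y
        refine (congrArg f (map_add πU x y).symm).trans ?_
        rw [hfσ', hfσ', hfσ', resFun_add, map_add])
      (fun g hg x => by
        have : N.toSubgroup.Normal := N.isNormal'
        obtain ⟨g, hgH, n, hn, rfl⟩ := Subgroup.mem_sup_of_normal_right.1 hg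
        rw [map_mul, mul_smul, mul_smul, hNV hn, U.of_smul_coinvariants hn]
        obtain ⟨x, rfl⟩ := hπU x
        refine (congrArg f (map_smul πU _ x).symm).trans ?_
        rw [hfσ', hfσ', map_of_smul H σ ⟨g, hgH⟩, map_smul])
      (fun c x => by
        obtain ⟨x, rfl⟩ := hπU x
        refine (congrArg f (map_smul πU _ x).symm).trans ?_
        rw [hfσ', hfσ', map_algebraMap_smul, map_smul])
  obtain ⟨ρ, hρ⟩ := h N (V.quotient P hPc) (W.quotient C hC) φ' β'
    (fun y => by
      obtain ⟨w, rfl⟩ := W.quotientMk_surjective C hC y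
      obtain ⟨v, rfl⟩ := hβ w
      exact ⟨πV v, hβ'v v⟩)
    ⟨σ', (resHom_comp_eq_iff _ _ _ _).2 fun x => by
      obtain ⟨u, rfl⟩ := hπU x
      refine (congrArg β' (hfσ' u)).trans ?_
      rw [hβ'v, hσ]
      exact (hφ'u u).symm⟩
  -- A lift modulo `P` agrees with `φ` up to an element of `β(P)`, which is absorbed by changing the
  -- representative `v` within its class modulo `P`.
  refine ⟨ρ.comp πU, fun u => ?_⟩
  obtain ⟨v, hv⟩ := V.quotientMk_surjective P hPc (ρ (πU u))
  have hu : πW (β v) = πW (φ u) := by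
    rw [← hβ'v, ← hφ'u]
    exact (congrArg β' hv).trans (DFunLike.congr_fun hρ (πU u))
  obtain ⟨p, hp, hpv⟩ := quotientMk_eq_iff.1 hu
  refine ⟨v - p, ?_, ?_⟩
  · refine Eq.trans ?_ hv
    exact quotientMk_eq_iff.2 (by simpa using P.neg_mem hp)
  · rw [map_sub, sub_eq_iff_eq_add, ← sub_eq_iff_eq_add']
    exact hpv.symm

end Coinvariants
end ProfiniteModule

/-! ### Functions on cosets and Higman's criterion -/

namespace ProfiniteModule

section CosetMatrix

variable {k G : Type u} [Field k] [Group G]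

/-- The homomorphism from `G` to matrices over `k[G/N]` indexed by `G/L`, sending `g` to `g` times
the permutation matrix of the action of `g` on `G/L`. -/
noncomputable def cosetMatrix (k : Type u) {G : Type u} [Field k] [Group G] (L N : Subgroup G)
    [N.Normal] [Fintype (G ⧸ L)] [DecidableEq (G ⧸ L)] :
    G →* Matrix (G ⧸ L) (G ⧸ L) (MonoidAlgebra k (G ⧸ N)) where
  toFun g := Matrix.of fun y x =>
    if g • x = y then MonoidAlgebra.of k (G ⧸ N) (g : G ⧸ N) else 0
  map_one' := by
    ext1 y x
    simp only [one_smul, Matrix.one_apply, QuotientGroup.mk_one, map_one, eq_comm,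
      Matrix.of_apply]
  map_mul' g h := by
    ext1 y x
    rw [Matrix.mul_apply, Finset.sum_eq_single (h • x)]
    · simp only [Matrix.of_apply, mul_smul, if_true, QuotientGroup.mk_mul, map_mul, ite_mul,
        zero_mul]
    · intro z _ hz
      rw [Matrix.of_apply, Matrix.of_apply, if_neg (Ne.symm hz), mul_zero]
    · simp

/-- The linear extension of `cosetMatrix` to `k[G/K]`: a normal subgroup `K ≤ L` acts trivially on
`G/L`, so for `K ≤ N` the matrix of `g` only depends on the class of `g` modulo `K`. -/
noncomputable def cosetMatrixAlgHom (k : Type u) {G : Type u} [Field k] [Group G]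
    (L N K : Subgroup G) [N.Normal] [K.Normal] [Fintype (G ⧸ L)] [DecidableEq (G ⧸ L)]
    (hKN : K ≤ N) (hKL : K ≤ L) :
    MonoidAlgebra k (G ⧸ K) →ₐ[k] Matrix (G ⧸ L) (G ⧸ L) (MonoidAlgebra k (G ⧸ N)) :=
  MonoidAlgebra.lift k _ (G ⧸ K) (QuotientGroup.lift K (cosetMatrix k L N) fun n hn => by
    ext1 y x
    obtain ⟨x, rfl⟩ := QuotientGroup.mk_surjective x
    have h1 : n • (x : G ⧸ L) = x := by
      refine (QuotientGroup.eq.2 (hKL ?_)).symm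
      have := Subgroup.Normal.conj_mem (H := K) inferInstance n hn x⁻¹
      simpa [mul_assoc] using this
    have h2 : (n : G ⧸ N) = 1 := (QuotientGroup.eq_one_iff n).2 (hKN hn)
    simp only [cosetMatrix, MonoidHom.coe_mk, OneHom.coe_mk, h1, h2, map_one, Matrix.one_apply,
      Matrix.of_apply, eq_comm])

theorem cosetMatrixAlgHom_single (L N K : Subgroup G) [N.Normal] [K.Normal] [Fintype (G ⧸ L)]
    [DecidableEq (G ⧸ L)] (hKN : K ≤ N) (hKL : K ≤ L) (g : G) (c : k) (y x : G ⧸ L) :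
    cosetMatrixAlgHom k L N K hKN hKL (MonoidAlgebra.single (g : G ⧸ K) c) y x =
      if g • x = y then MonoidAlgebra.single (g : G ⧸ N) c else 0 := by
  rw [cosetMatrixAlgHom, MonoidAlgebra.lift_single]
  change c • (if g • x = y then MonoidAlgebra.of k (G ⧸ N) (g : G ⧸ N) else 0) = _
  split_ifs <;> simp

theorem transition_cosetMatrixAlgHom (L N N' K K' : Subgroup G) [N.Normal] [K.Normal] [N'.Normal]
    [K'.Normal] [Fintype (G ⧸ L)] [DecidableEq (G ⧸ L)] (hKN : K ≤ N) (hKL : K ≤ L)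
    (hKN' : K' ≤ N') (hKL' : K' ≤ L) (hN : N ≤ N') (hK : K ≤ K') (a : MonoidAlgebra k (G ⧸ K))
    (y x : G ⧸ L) :
    groupAlgebraTransition k hN (cosetMatrixAlgHom k L N K hKN hKL a y x) =
      cosetMatrixAlgHom k L N' K' hKN' hKL' (groupAlgebraTransition k hK a) y x := by
  induction a using MonoidAlgebra.induction_linear with
  | zero => simp only [map_zero, Matrix.zero_apply]
  | add a b ha hb => simp only [map_add, Matrix.add_apply, ha, hb]
  | single q c =>
    obtain ⟨g, rfl⟩ := QuotientGroup.mk_surjective q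
    rw [cosetMatrixAlgHom_single, groupAlgebraTransition_single, cosetMatrixAlgHom_single]
    split_ifs
    · exact groupAlgebraTransition_single k hN g c
    · exact map_zero _

end CosetMatrix

section CosetFunctions

variable {k G : Type u} [Field k] [Group G] [TopologicalSpace G]

/-- The function underlying `completedCosetMatrix`. As the open normal subgroup `M ≤ L` acts
trivially on `G/L`, the `N`-th coordinates of the entries can be computed from the image of `r` in
`k[G/(N ∩ M)]`. -/
noncomputable def completedCosetMatrixFun (L : Subgroup G) [Fintype (G ⧸ L)]
    [DecidableEq (G ⧸ L)] (M : OpenNormalSubgroup G) (hM : M.toSubgroup ≤ L)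
    (r : CompletedGroupAlgebra k G) : Matrix (G ⧸ L) (G ⧸ L) (CompletedGroupAlgebra k G) :=
  Matrix.of fun y x => ⟨fun N => cosetMatrixAlgHom k L N.toSubgroup (N ⊓ M).toSubgroup
      inf_le_left (inf_le_right.trans hM) (CompletedGroupAlgebra.proj (N ⊓ M) r) y x,
    fun N N' h =>
      (transition_cosetMatrixAlgHom L _ _ _ _ _ _ _ _ h (inf_le_inf_right _ h) _ y x).trans
        (congrArg (fun a => cosetMatrixAlgHom k L N'.toSubgroup (N' ⊓ M).toSubgroup inf_le_left
            (inf_le_right.trans hM) a y x)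
          (CompletedGroupAlgebra.proj_compat r (N := N ⊓ M) (M := N' ⊓ M)
            (inf_le_inf_right _ h)))⟩

theorem proj_completedCosetMatrixFun (L : Subgroup G) [Fintype (G ⧸ L)] [DecidableEq (G ⧸ L)]
    (M : OpenNormalSubgroup G) (hM : M.toSubgroup ≤ L) (N : OpenNormalSubgroup G)
    (r : CompletedGroupAlgebra k G) (y x : G ⧸ L) :
    CompletedGroupAlgebra.proj N (completedCosetMatrixFun L M hM r y x) =
      cosetMatrixAlgHom k L N.toSubgroup (N ⊓ M).toSubgroup inf_le_left
        (inf_le_right.trans hM) (CompletedGroupAlgebra.proj (N ⊓ M) r) y x := rfl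

/-- The ring homomorphism from `k[[G]]` to matrices over `k[[G]]` indexed by `G/L`, sending `g` to
`g` times the permutation matrix of `g`. -/
noncomputable def completedCosetMatrix (L : Subgroup G) [Fintype (G ⧸ L)] [DecidableEq (G ⧸ L)]
    (M : OpenNormalSubgroup G) (hM : M.toSubgroup ≤ L) :
    CompletedGroupAlgebra k G →+* Matrix (G ⧸ L) (G ⧸ L) (CompletedGroupAlgebra k G) where
  toFun := completedCosetMatrixFun L M hM
  map_one' := by
    ext1 y x
    refine CompletedGroupAlgebra.ext_proj fun N => ?_
    rw [proj_completedCosetMatrixFun, map_one, map_one, Matrix.one_apply, Matrix.one_apply]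
    split_ifs
    · exact (map_one _).symm
    · exact (map_zero _).symm
  map_zero' := by
    ext1 y x
    refine CompletedGroupAlgebra.ext_proj fun N => ?_
    rw [proj_completedCosetMatrixFun, map_zero, map_zero, Matrix.zero_apply, Matrix.zero_apply,
      map_zero]
  map_add' r s := by
    ext1 y x
    refine CompletedGroupAlgebra.ext_proj fun N => ?_
    rw [proj_completedCosetMatrixFun, map_add, map_add, Matrix.add_apply, Matrix.add_apply,
      map_add, proj_completedCosetMatrixFun, proj_completedCosetMatrixFun]
  map_mul' r s := by
    ext1 y x
    refine CompletedGroupAlgebra.ext_proj fun N => ?_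
    rw [proj_completedCosetMatrixFun, map_mul, map_mul, Matrix.mul_apply, Matrix.mul_apply,
      map_sum]
    refine Finset.sum_congr rfl fun z _ => ?_
    rw [map_mul, proj_completedCosetMatrixFun, proj_completedCosetMatrixFun]

theorem proj_completedCosetMatrix (L : Subgroup G) [Fintype (G ⧸ L)] [DecidableEq (G ⧸ L)]
    (M : OpenNormalSubgroup G) (hM : M.toSubgroup ≤ L) (N : OpenNormalSubgroup G)
    (r : CompletedGroupAlgebra k G) (y x : G ⧸ L) :
    CompletedGroupAlgebra.proj N (completedCosetMatrix L M hM r y x) =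
      cosetMatrixAlgHom k L N.toSubgroup (N ⊓ M).toSubgroup inf_le_left
        (inf_le_right.trans hM) (CompletedGroupAlgebra.proj (N ⊓ M) r) y x := rfl

theorem completedCosetMatrix_of (L : Subgroup G) [Fintype (G ⧸ L)] [DecidableEq (G ⧸ L)]
    (M : OpenNormalSubgroup G) (hM : M.toSubgroup ≤ L) (g : G) (y x : G ⧸ L) :
    completedCosetMatrix L M hM (CompletedGroupAlgebra.of k g) y x =
      if g • x = y then CompletedGroupAlgebra.of k g else 0 := by
  refine CompletedGroupAlgebra.ext_proj fun N => ?_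
  rw [proj_completedCosetMatrix, CompletedGroupAlgebra.proj_of]
  refine (cosetMatrixAlgHom_single L _ _ _ _ g 1 y x).trans ?_
  split_ifs
  · rfl
  · exact (map_zero _).symm

theorem completedCosetMatrix_algebraMap (L : Subgroup G) [Fintype (G ⧸ L)]
    [DecidableEq (G ⧸ L)] (M : OpenNormalSubgroup G) (hM : M.toSubgroup ≤ L) (c : k)
    (y x : G ⧸ L) :
    completedCosetMatrix L M hM (algebraMap k _ c) y x =
      if x = y then algebraMap k (CompletedGroupAlgebra k G) c else 0 := by
  refine CompletedGroupAlgebra.ext_proj fun N => ?_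
  rw [proj_completedCosetMatrix, AlgHom.commutes, AlgHom.commutes, Matrix.algebraMap_matrix_apply]
  simp only [eq_comm (a := y)]
  split_ifs
  · exact (AlgHom.commutes _ c).symm
  · exact (map_zero _).symm

attribute [local instance] groupAlgebraDiscrete in
theorem continuous_completedCosetMatrix (L : Subgroup G) [Fintype (G ⧸ L)]
    [DecidableEq (G ⧸ L)] (M : OpenNormalSubgroup G) (hM : M.toSubgroup ≤ L) (y x : G ⧸ L) :
    Continuous fun r : CompletedGroupAlgebra k G => completedCosetMatrix L M hM r y x :=
  CompletedGroupAlgebra.continuous_of_proj fun N =>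
    have (Q : Type u) : DiscreteTopology (MonoidAlgebra k Q) := ⟨rfl⟩
    (continuous_of_discreteTopology (f := fun a => cosetMatrixAlgHom k L N.toSubgroup
      (N ⊓ M).toSubgroup inf_le_left (inf_le_right.trans hM) a y x)).comp
        (CompletedGroupAlgebra.continuous_proj (N ⊓ M))

open scoped Matrix.Module in
/-- The module of functions `f : G/L → U` for an open subgroup `L`, where `g` acts by
`(g f)(g x) = g (f x)`. The action of `k[[G]]` is the pullback of the action of matrices along
`completedCosetMatrix`; up to isomorphism it does not depend on the auxiliary subgroup `M`. -/
noncomputable def cosetFunctions (L : Subgroup G) [Fintype (G ⧸ L)] [DecidableEq (G ⧸ L)]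
    (M : OpenNormalSubgroup G) (hM : M.toSubgroup ≤ L)
    (U : ProfiniteModule (CompletedGroupAlgebra k G)) :
    ProfiniteModule (CompletedGroupAlgebra k G) :=
  { carrier := G ⧸ L → U
    module := Module.compHom (G ⧸ L → U) (completedCosetMatrix (k := k) L M hM)
    continuousSMul := @ContinuousSMul.mk _ _ (_) _ _ (continuous_pi fun y =>
      continuous_finsetSum _ fun x _ =>
        ((continuous_completedCosetMatrix L M hM y x).comp continuous_fst).smul
          ((continuous_apply x).comp continuous_snd)) }

variable {L : Subgroup G} [Fintype (G ⧸ L)] [DecidableEq (G ⧸ L)] {M : OpenNormalSubgroup G}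
  {hM : M.toSubgroup ≤ L} {U : ProfiniteModule (CompletedGroupAlgebra k G)}

theorem cosetFunctions_smul_apply (r : CompletedGroupAlgebra k G) (f : cosetFunctions L M hM U)
    (y : G ⧸ L) :
    (show G ⧸ L → U from r • f) y =
      ∑ x, completedCosetMatrix L M hM r y x • (show G ⧸ L → U from f) x := rfl

theorem cosetFunctions_of_smul_apply (g : G) (f : cosetFunctions L M hM U) (x : G ⧸ L) :
    (show G ⧸ L → U from CompletedGroupAlgebra.of k g • f) (g • x) =
      CompletedGroupAlgebra.of k g • (show G ⧸ L → U from f) x := by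
  rw [cosetFunctions_smul_apply, Finset.sum_eq_single x]
  · rw [completedCosetMatrix_of, if_pos rfl]
  · intro z _ hz
    rw [completedCosetMatrix_of, if_neg fun h => hz (smul_left_cancel g h), zero_smul]
  · simp

theorem cosetFunctions_algebraMap_smul_apply (c : k) (f : cosetFunctions L M hM U) (x : G ⧸ L) :
    (show G ⧸ L → U from algebraMap k (CompletedGroupAlgebra k G) c • f) x =
      algebraMap k (CompletedGroupAlgebra k G) c • (show G ⧸ L → U from f) x := by
  rw [cosetFunctions_smul_apply, Finset.sum_eq_single x]
  · rw [completedCosetMatrix_algebraMap, if_pos rfl]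
  · intro z _ hz
    rw [completedCosetMatrix_algebraMap, if_neg hz, zero_smul]
  · simp

/-- The homomorphism `f ↦ ∑ x, f x`. -/
noncomputable def cosetFunctionsSum (L : Subgroup G) [Fintype (G ⧸ L)] [DecidableEq (G ⧸ L)]
    (M : OpenNormalSubgroup G) (hM : M.toSubgroup ≤ L)
    (U : ProfiniteModule (CompletedGroupAlgebra k G)) :
    cosetFunctions L M hM U →L[CompletedGroupAlgebra k G] U :=
  have hc : Continuous fun f : G ⧸ L → U => ∑ x, f x :=
    continuous_finsetSum _ fun x _ => continuous_apply x
  have ha (f g : G ⧸ L → U) : ∑ x, (f + g) x = ∑ x, f x + ∑ x, g x := Finset.sum_add_distrib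
  { toFun := fun f : G ⧸ L → U => ∑ x, f x
    map_add' := ha
    map_smul' := map_smul_of_commutes (U := cosetFunctions L M hM U) (W := U) hc ha
      (fun g f => by
        change ∑ x, (show G ⧸ L → U from CompletedGroupAlgebra.of k g • f) x =
          CompletedGroupAlgebra.of k g • ∑ x, (show G ⧸ L → U from f) x
        rw [Finset.smul_sum, ← Equiv.sum_comp (MulAction.toPerm g)]
        exact Finset.sum_congr rfl fun x _ => cosetFunctions_of_smul_apply g f x)
      (fun c f => by
        change ∑ x, (show G ⧸ L → U from algebraMap k _ c • f) x =
          algebraMap k (CompletedGroupAlgebra k G) c • ∑ x, (show G ⧸ L → U from f) x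
        rw [Finset.smul_sum]
        exact Finset.sum_congr rfl fun x _ => cosetFunctions_algebraMap_smul_apply c f x)
    cont := hc }

/-- Higman's criterion: if `U` is relatively projective for an open subgroup `L`, its identity is
a trace from `L`. The summation map from functions `G/L → U` to `U` is split over `k[[L]]` by
functions supported at the trivial coset; for a `k[[G]]`-splitting `ρ`, the endomorphism
`u ↦ ρ u 1` has trace the identity. -/
theorem IsRelativelyProjective.exists_trace_eq_id [IsTopologicalGroup G] [CompactSpace G]
    [TotallyDisconnectedSpace G] {L : Subgroup G} (hL : IsOpen (L : Set G))
    {U : ProfiniteModule (CompletedGroupAlgebra k G)} (hU : U.IsRelativelyProjective L) :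
    ∃ α : res L U →L[CompletedGroupAlgebra k L] res L U,
      ContinuousLinearMap.id (CompletedGroupAlgebra k G) U = trace L hL α := by
  classical
  have : Finite (G ⧸ L) := Subgroup.quotient_finite_of_isOpen L hL
  let : Fintype (G ⧸ L) := Fintype.ofFinite _
  obtain ⟨M, hM⟩ := ProfiniteGrp.exist_openNormalSubgroup_sub_open_nhds_of_one hL L.one_mem
  have hM' : M.toSubgroup ≤ L := hM
  have hL1 {g : G} (hg : g ∈ L) : g • ((1 : G) : G ⧸ L) = (1 : G) :=
    QuotientGroup.eq.2 (by simpa using hg)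
  -- `ι u` is the function with value `u` at the trivial coset and zero elsewhere.
  let ι (u : U) : cosetFunctions L M hM' U := (Pi.single ((1 : G) : G ⧸ L) u : G ⧸ L → U)
  have hι (u : U) (x : G ⧸ L) :
      (show G ⧸ L → U from ι u) x = if x = (1 : G) then u else 0 := Pi.single_apply _ _ _
  have hιsum (u : U) : cosetFunctionsSum L M hM' U (ι u) = u := by
    change ∑ x, (show G ⧸ L → U from ι u) x = u
    simp only [hι, Finset.sum_ite_eq', Finset.mem_univ, if_true]
  let σ : res L U →L[CompletedGroupAlgebra k L] res L (cosetFunctions L M hM' U) :=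
    resHomOfCommutes L ι (continuous_single (A := fun _ : G ⧸ L => U) ((1 : G) : G ⧸ L))
      (fun u v => Pi.single_add (f := fun _ : G ⧸ L => U) _ u v)
      (fun g hg u => by
        refine funext fun y => ?_
        obtain ⟨x, rfl⟩ : ∃ x, g • x = y := ⟨g⁻¹ • y, smul_inv_smul g y⟩
        refine Eq.trans ?_ (cosetFunctions_of_smul_apply g (ι u) x).symm
        refine (hι _ _).trans ?_
        rw [hι]
        have : g • x = ((1 : G) : G ⧸ L) ↔ x = (1 : G) := by
          conv_lhs => rw [← hL1 hg]
          exact smul_left_cancel_iff g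
        simp only [this, smul_ite, smul_zero])
      (fun c u => by
        refine funext fun x => ?_
        refine Eq.trans ?_ (cosetFunctions_algebraMap_smul_apply c (ι u) x).symm
        refine (hι _ _).trans ?_
        rw [hι, smul_ite, smul_zero])
  obtain ⟨ρ, hρ⟩ := hU (cosetFunctions L M hM' U) U (ContinuousLinearMap.id _ U)
    (cosetFunctionsSum L M hM' U) (fun u => ⟨ι u, hιsum u⟩)
    ⟨σ, (resHom_comp_eq_iff _ _ _ _).2 hιsum⟩
  let ev (u : U) (x : G ⧸ L) : U := (show G ⧸ L → U from ρ u) x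
  have hev (g : G) (u : U) (x : G ⧸ L) :
      ev (CompletedGroupAlgebra.of k g • u) (g • x) = CompletedGroupAlgebra.of k g • ev u x := by
    refine Eq.trans ?_ (cosetFunctions_of_smul_apply g (ρ u) x)
    exact congrArg (fun f : cosetFunctions L M hM' U => (show G ⧸ L → U from f) (g • x))
      (map_smul ρ _ u)
  let α : res L U →L[CompletedGroupAlgebra k L] res L U :=
    resHomOfCommutes L (fun u => ev u (1 : G))
      ((continuous_apply (A := fun _ : G ⧸ L => U) ((1 : G) : G ⧸ L)).comp ρ.continuous)
      (fun u v => congrArg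
        (fun f : cosetFunctions L M hM' U => (show G ⧸ L → U from f) (1 : G)) (map_add ρ u v))
      (fun g hg u => by
        conv_lhs => rw [← hL1 hg]
        exact hev g u _)
      (fun c u => by
        refine Eq.trans ?_ (cosetFunctions_algebraMap_smul_apply c (ρ u) (1 : G))
        exact congrArg (fun f : cosetFunctions L M hM' U => (show G ⧸ L → U from f) (1 : G))
          (map_smul ρ _ u))
  refine ⟨α, ContinuousLinearMap.ext fun u => ?_⟩
  rw [trace_apply]
  refine (DFunLike.congr_fun hρ u).symm.trans (Finset.sum_congr rfl fun s _ => ?_)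
  obtain ⟨s, rfl⟩ := QuotientGroup.mk_surjective s
  rw [cosetConj_mk, conj]
  refine Eq.trans ?_ (hev s (CompletedGroupAlgebra.of k s⁻¹ • u) (1 : G))
  rw [← mul_smul, ← map_mul, mul_inv_cancel, map_one, one_smul]
  exact congrArg (ev u) (congrArg (QuotientGroup.mk) (mul_one s)).symm

end CosetFunctions
end ProfiniteModule

/-! ### The equivalence -/

theorem theorem3
    (k : Type u) [Field k] [Finite k]
    (G : Type u) [Group G] [TopologicalSpace G] [IsTopologicalGroup G] [CompactSpace G]
    [T2Space G] [TotallyDisconnectedSpace G]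
    (H : Subgroup G) (hH : IsClosed (H : Set G))
    (U : ProfiniteModule.{u} (CompletedGroupAlgebra k G))
    (hU : Module.Finite (CompletedGroupAlgebra k G) U) :
    List.TFAE
      [U.IsRelativelyProjective H,
       ∀ (V : ProfiniteModule.{u} (CompletedGroupAlgebra k G))
         (β : V →L[CompletedGroupAlgebra k G] U), Function.Surjective β →
         ProfiniteModule.Splits (ProfiniteModule.resHom H β) → ProfiniteModule.Splits β,
       U.IsSummand (ProfiniteModule.ind H (ProfiniteModule.res H U)),
       ∀ N : OpenNormalSubgroup G, U.IsRelativelyProjective (H ⊔ N.toSubgroup),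
       ∀ N : OpenNormalSubgroup G,
         (ProfiniteModule.coinvariants N.toSubgroup U).IsRelativelyProjective (H ⊔ N.toSubgroup),
       ∃ V : ProfiniteModule.{u} (CompletedGroupAlgebra k H),
         U.IsSummand (ProfiniteModule.ind H V),
       ∀ N : OpenNormalSubgroup G,
         ∃ α : ProfiniteModule.res (H ⊔ N.toSubgroup) U
             →L[CompletedGroupAlgebra k (H ⊔ N.toSubgroup : Subgroup G)]
             ProfiniteModule.res (H ⊔ N.toSubgroup) U,
           ContinuousLinearMap.id (CompletedGroupAlgebra k G) U =
             ProfiniteModule.trace (H ⊔ N.toSubgroup) (isOpen_sup_openNormal H N) α] := by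
  tfae_have 1 → 2 := fun h V β hβ hs => h.splits β hβ hs
  tfae_have 2 → 3 := fun h => ProfiniteModule.isSummand_ind_res_of_splits H U h
  tfae_have 3 → 6 := fun h => ⟨_, h⟩
  tfae_have 6 → 1 := fun ⟨V, hV⟩ =>
    (ProfiniteModule.isRelativelyProjective_ind H V).of_isSummand hV
  tfae_have 1 → 4 := fun h N => h.mono le_sup_left
  tfae_have 4 → 7 := fun h N => (h N).exists_trace_eq_id (isOpen_sup_openNormal H N)
  tfae_have 7 → 5 := fun h N => (h N).elim fun α hα =>
    ProfiniteModule.isRelativelyProjective_coinvariants_of_trace N.toSubgroup _ le_sup_right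
      (isOpen_sup_openNormal H N) U α hα
  tfae_have 5 → 1 := fun h => ProfiniteModule.isRelativelyProjective_of_coinvariants H U hU h
  tfae_finish
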